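/- Setting. Let $G=(V,E)$ be a connected undirected graph with $V=\{1,\dots,N\}$, let $A=\{1,\dots,K\}$ with $K\ge 2$, let $T\ge 1$, and let $\ell_t(i)\in[0,1]$ ($t\ge 1$, $i\in A$) be losses fixed in advance (oblivious adversary). Each agent $v\in V$ has a delay $d(v)\in\mathbb N$ and a time-to-live $ttl(v)\in\mathbb N$. The directed graph $G_{\mathcal P}$ on $V$ has the arc $(v',v)$ iff $\mathrm{dist}_G(v',v)\le\min\{d(v),ttl(v')\}$; $N^-_{\mathcal P}(v)=\{v' : (v',v)\text{ is an arc}\}\ni v$; $\alpha(G_{\mathcal P})$ is the independence number of $G_{\mathcal P}$ with orientations and self-loops disregarded; $\bar d_V=\frac1N\sum_{v\in V}d(v)$. Algorithm (Exp3-Coop2 with $\delta=1/T$ and the doubling trick). In round $t=1,\dots,T$ every agent $v$ draws $I_t(v)\in A$ from $\boldsymbol p_t(v)=(p_t(i,v))_{i\in A}$, independently of the other agents given the past, where $$p_t(i,v)=\frac{\widetilde p_t(i,v)}{\sum_{j\in A}\widetilde p_t(j,v)},\qquad \widetilde p_t(i,v)=\max\Bigl\{\frac{w_t(i,v)}{\sum_{j\in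 A} w_t(j,v)},\frac{\delta}{K}\Bigr\}.$$ Put $q_s(i,v)=1-\prod_{v'\in N^-_{\mathcal P}(v)}(1-p_s(i,v'))$ and let $B_s(i,v)\in\{0,1\}$ indicate that some $v'\in N^-_{\mathcal P}(v)$ has $I_s(v')=i$. Agent $v$ starts in stage $r_0(v)=\lceil\log_2\ln K+2\log_2(Ke(d(v)+1))\rceil$ with all weights equal to $1$; in stage $r$ it uses the learning rate $\eta_r(v)=\gamma_r(v)/(Ke(d(v)+1))$ with $\gamma_r(v)=Ke(d(v)+1)\sqrt{(\ln K)/2^r}$. At the end of round $t$, let $n$ be the number of rounds of $v$'s current stage so far, round $t$ included; if $n>d(v)$ put, with $s=t-d(v)$, $$\widehat\ell_t(i,v)=\frac{\ell_s(i)}{q_s(i,v)}B_s(i,v),\qquad Q_t(v)=d(v)+\frac e2\sum_{i\in A}\frac{p_s(i,v)}{q_s(i,v)},$$ and otherwise put $\widehat\ell_t(i,v)=Q_t(v)=0$. If the sum of the $Q$'s of the current stage (round $t$ included) exceeds $2^r$, then $v$ restarts in stage $r+1$, with all weights reset to $1$; otherwise $w_{t+1}(i,v)=p_t(i,v)\exp(-\eta_r(v)\widehat\ell_t(i,v))$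 for all $i\in A$. Claim. There are absolute constants $C>0$ and $m\in\mathbb N$ such that, for all $G,N,K,T,d,ttl$ and $\ell$ as above, the average welfare regret $$R_T^{\mathrm{coop}}=\frac1N\sum_{v\in V}\mathbb E\Bigl[\sum_{t=1}^T\ell_t(I_t(v))\Bigr]-\min_{i\in A}\sum_{t=1}^T\ell_t(i)$$ satisfies $$R_T^{\mathrm{coop}}\le C\Bigl(\sqrt{(\ln K)\bigl(\bar d_V+1+\tfrac KN\,\alpha(G_{\mathcal P})\ln(TNK)\bigr)T}+\bar d_V\bigl(\ln T+\ln\ln(TNK)\bigr)\Bigr)+C\Bigl(N+K+\sum_{v\in V}d(v)\Bigr)^m .$$ In particular, as $T$ grows large, $R_T^{\mathrm{coop}}=\mathcal O\Bigl(\sqrt{(\ln K)\bigl(\bar d_V+1+\tfrac KN\,\alpha(G_{\mathcal P})\ln(TNK)\bigr)T}+\bar d_V\bigl(\ln T+\ln\ln(TNK)\bigr)\Bigr)$ with an absolute constant. -/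

import Mathlib

noncomputable section

namespace ExpCoop

/-- The arc relation `(u, v) ∈ E_P` of the directed graph `G_P`: messages generated by `u` reach `v`
and are used by `v`, i.e. the shortest-path distance of `u` and `v` in `G` is at most
`min (d v) (ttl u)`. -/
def Arc {V : Type*} (G : SimpleGraph V) (d ttl : V → ℕ) (u v : V) : Prop :=
  G.edist u v ≤ ((min (d v) (ttl u) : ℕ) : ℕ∞)

open Classical in
/-- The in-neighborhood `N⁻_P(v)` of `v` in `G_P` (it contains `v`). -/
def inNbhd {V : Type*} [Fintype V] (G : SimpleGraph V) (d ttl : V → ℕ) (v : V) : Finset V :=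
  Finset.univ.filter (fun u => Arc G d ttl u v)

/-- The independence number `α(G_P)`: orientations (and self-loops) are disregarded. -/
def alphaP {V : Type*} [Fintype V] (G : SimpleGraph V) (d ttl : V → ℕ) : ℕ :=
  (SimpleGraph.fromRel (Arc G d ttl)).indepNum

/-- The clipped weights `p̃(i) = max {w(i) / W, δ / K}` with `W = ∑ j, w(j)`. -/
def clipped {K : ℕ} (δ : ℝ) (w : Fin K → ℝ) (i : Fin K) : ℝ :=
  max (w i / ∑ j, w j) (δ / K)

/-- The distribution `p(i) = p̃(i) / P̃` with `P̃ = ∑ j, p̃(j)` from which an agent with weights `w`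
draws its action. -/
def actionProb {K : ℕ} (δ : ℝ) (w : Fin K → ℝ) (i : Fin K) : ℝ :=
  clipped δ w i / ∑ j, clipped δ w j

/-- `q(i) = 1 - ∏ u ∈ S, (1 - p(i, u))`: the probability that some agent of `S` plays `i`, when the
agents draw their actions independently from the distributions `p u`. -/
def hitProb {V : Type*} {K : ℕ} (S : Finset V) (p : V → Fin K → ℝ) (i : Fin K) : ℝ :=
  1 - ∏ u ∈ S, (1 - p u i)

/-- The factor `K e (d + 1)`. -/
def scale (K d : ℕ) : ℝ := K * Real.exp 1 * (d + 1)

/-- The doubling-trick parameter `γ_r = K e (d + 1) √(ln K / 2 ^ r)` of an agent with delay `d`. -/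
def gammaStage (K d r : ℕ) : ℝ := scale K d * √(Real.log K / 2 ^ r)

/-- The learning rate `η = γ_r / (K e (d + 1))` used in stage `r` by an agent with delay `d`. -/
def etaStage (K d r : ℕ) : ℝ := gammaStage K d r / scale K d

/-- The first stage `r₀ = ⌈log₂ ln K + 2 log₂ (K e (d + 1))⌉` (which is positive for `2 ≤ K`). -/
def firstStage (K d : ℕ) : ℕ :=
  ⌈Real.logb 2 (Real.log K) + 2 * Real.logb 2 (scale K d)⌉₊

/-- What an agent remembers at the beginning of a round. -/
structure AgentState (K : ℕ) where
  /-- The weights `w(i)`. -/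
  weight : Fin K → ℝ
  /-- The current stage `r` of the doubling trick. -/
  stage : ℕ
  /-- The number of the present round, counted from `1` at the last restart. -/
  clock : ℕ
  /-- The sum of `Q_s` over the rounds `s` since the last restart, the present one excluded. -/
  total : ℝ

/-- The state in which an agent (re)starts the algorithm in stage `r`. -/
def AgentState.fresh (K r : ℕ) : AgentState K where
  weight := fun _ => 1
  stage := r
  clock := 1
  total := 0

/-- The importance-weighted loss estimate of an agent whose local clock is `clock`; `oldLoss`, `q`
and `hit` are the losses, the probabilities `q` and the events `B` of the round `d` rounds ago. -/
def lossEst {K : ℕ} (d clock : ℕ) (oldLoss q : Fin K → ℝ) (hit : Fin K → Prop)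
    (i : Fin K) : ℝ :=
  open Classical in
  if d < clock then oldLoss i / q i * (if hit i then 1 else 0) else 0

/-- The quantity `Q` of the doubling trick; `oldProb` and `q` are the agent's own distribution and
the probabilities `q` of the round `d` rounds ago. -/
def qTerm {K : ℕ} (d clock : ℕ) (oldProb q : Fin K → ℝ) : ℝ :=
  if d < clock then (d : ℝ) + Real.exp 1 / 2 * ∑ i, oldProb i / q i else 0

/-- The transition at the end of a round: if the sum of the `Q`'s since the last restart exceeds
`2 ^ r`, the agent restarts the algorithm in stage `r + 1`; otherwise it performs the exponential
update with the learning rate of stage `r`. Here `est` are the loss estimates and `Q` is the value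
of `Q` of the present round. -/
def AgentState.next {K : ℕ} (δ : ℝ) (d : ℕ) (s : AgentState K) (est : Fin K → ℝ) (Q : ℝ) :
    AgentState K :=
  open Classical in
  if (2 : ℝ) ^ s.stage < s.total + Q then
    AgentState.fresh K (s.stage + 1)
  else
    { weight := fun i => actionProb δ s.weight i * Real.exp (-(etaStage K d s.stage) * est i)
      stage := s.stage
      clock := s.clock + 1
      total := s.total + Q }

/-- `run G d ttl δ ℓ a t v` is the state of agent `v` at the beginning of round `t` when Exp3-Coop2
is run with exploration parameter `δ` on the losses `ℓ`, each agent tuning its learning rate by the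
doubling trick, and `a t v` is the action played by `v` in round `t`. Rounds are numbered
`0, …, T - 1`. The state at the beginning of round `t` depends on the actions of earlier rounds
only, and `t - d v` below is used only when `d v < clock ≤ t + 1`, so it is not truncated. -/
def run {V : Type*} [Fintype V] {K T : ℕ} (G : SimpleGraph V) (d ttl : V → ℕ) (δ : ℝ)
    (ℓ : ℕ → Fin K → ℝ) (a : Fin T → V → Fin K) : ℕ → V → AgentState K
  | 0 => fun v => AgentState.fresh K (firstStage K (d v))
  | t + 1 => fun v =>
      let S := inNbhd G d ttl v
      let s := run G d ttl δ ℓ a t v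
      let p : V → Fin K → ℝ := fun u => actionProb δ (run G d ttl δ ℓ a (t - d v) u).weight
      let hit : Fin K → Prop := fun i => ∃ u ∈ S, ∃ h : t - d v < T, a ⟨t - d v, h⟩ u = i
      s.next δ (d v)
        (lossEst (d v) s.clock (ℓ (t - d v)) (hitProb S p) hit)
        (qTerm (d v) s.clock (p v) (hitProb S p))
  termination_by t => t
  decreasing_by all_goals omega

/-- `p_t(i, v)`, as a function of the actions `a` played. -/
def playProb {V : Type*} [Fintype V] {K T : ℕ} (G : SimpleGraph V) (d ttl : V → ℕ) (δ : ℝ)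
    (ℓ : ℕ → Fin K → ℝ) (a : Fin T → V → Fin K) (t : ℕ) (v : V) (i : Fin K) : ℝ :=
  actionProb δ (run G d ttl δ ℓ a t v).weight i

/-- The probability that the agents play exactly the actions `a` in the rounds `0, …, T - 1`: given
the past, the actions of round `t` are drawn independently, `a t v` from the distribution
`p_t(·, v)`. -/
def trajProb {V : Type*} [Fintype V] {K T : ℕ} (G : SimpleGraph V) (d ttl : V → ℕ) (δ : ℝ)
    (ℓ : ℕ → Fin K → ℝ) (a : Fin T → V → Fin K) : ℝ :=
  ∏ t : Fin T, ∏ v : V, playProb G d ttl δ ℓ a t v (a t v)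

open Classical in
/-- The expectation of `f` with respect to the internal randomization of the agents. -/
def expect {V : Type*} [Fintype V] {K T : ℕ} (G : SimpleGraph V) (d ttl : V → ℕ) (δ : ℝ)
    (ℓ : ℕ → Fin K → ℝ) (f : (Fin T → V → Fin K) → ℝ) : ℝ :=
  ∑ a : Fin T → V → Fin K, trajProb G d ttl δ ℓ a * f a

/-- The average welfare regret after `T` rounds of Exp3-Coop2 with doubling trick and exploration
parameter `δ`. -/
def welfareRegret {V : Type*} [Fintype V] {K : ℕ} (G : SimpleGraph V) (d ttl : V → ℕ) (δ : ℝ)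
    (ℓ : ℕ → Fin K → ℝ) (T : ℕ) : ℝ :=
  (1 / (Fintype.card V : ℝ)) *
      ∑ v : V, expect G d ttl δ ℓ (fun a : Fin T → V → Fin K => ∑ t : Fin T, ℓ t (a t v))
    - ⨅ i : Fin K, ∑ t : Fin T, ℓ t i

/-- The average delay `d̄_V`. -/
def meanDelay {V : Type*} [Fintype V] (d : V → ℕ) : ℝ :=
  (1 / (Fintype.card V : ℝ)) * ∑ v : V, (d v : ℝ)

end ExpCoop

end

/-! Each agent runs exponential weights on delayed importance-weighted estimates. The state of `v`
in round `t`, its stage and its decision to restart depend only on rounds before `s = t - d v`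
(`dependsOn_run`, `dependsOn_qAt`), whereas the estimate of round `t` depends on the actions of
round `s`. Hence the estimate is conditionally unbiased even when multiplied by `p_t`, by the
learning rate and by the indicator of not restarting (`expect_mul_estAt`, `expect_mul_estAt_sq`).

In expectation, the regret of one agent has four sources. The potential `(1/η) ln p_t(k)` costs
`√(ln K · 2^r)` per stage (`sum_cont_le`). Replacing `p_s` by `p_t` costs about `d · η` per round,
because probabilities decrease slowly (`p_sub_p_succ_le`). The second moment costs `η · (e/2) ∑ p_s
/ q_s`, because probabilities grow by at most a factor `e` in `d` rounds (`p_le_exp_mul`). Rounds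
lost to delay or to restarts cost at most `d + 1` per stage, with `O(ln T)` stages. The drift and
second-moment costs add up to `η · Q`, which is why `Q` has its form: the rule `∑ Q ≤ 2^r` bounds
them by `√(ln K · 2^r)` per stage. A geometric sum over the stages leaves a multiple of the scale of
the last stage (`expect_regret_agent_le`).

Finally `2^r` for the last stage is at most `2 ∑ Q`, apart from the initial value, so averaging over
the agents requires a bound on `∑_v p(i,v) / q(i,v)`. The graph lemma `sum_div_hitProb_le` gives
`O(∑_v p(i,v) + α ln(TNK))`; summing over the `K` actions gives `O(N + K α ln(TNK))`. The bound
holds along every trajectory. The square roots are averaged by the arithmetic-geometric mean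
inequality, and the burn-in cost of the initial stages goes into the polynomial remainder. -/

noncomputable section

namespace ExpCoop

/-! ### Independence number and sums of `p / q` over the agents. -/

/-- Weighted Caro–Wei bound: `∑ p(v) / p(N[v])` over a vertex set is at most the independence
number. -/
theorem sum_div_closedNbhd_le_indepNum {V : Type*} [Fintype V] [DecidableEq V] (H : SimpleGraph V)
    [DecidableRel H.Adj] (p : V → ℝ) (hp : ∀ v, 0 < p v) (W : Finset V) :
    ∃ I : Finset V, I ⊆ W ∧ H.IsIndepSet (I : Set V) ∧
      ∑ v ∈ W, p v / ∑ u ∈ W with u = v ∨ H.Adj u v, p u ≤ I.card := by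
  induction W using Finset.strongInduction with
  | H W ih =>
  rcases W.eq_empty_or_nonempty with rfl | hW
  · exact ⟨∅, by simp⟩
  -- Greedy choice: `v` has the lightest closed neighborhood `A`. Every denominator over `A` is then
  -- at least `p(A)`, so deleting `A` removes at most `1` from the sum, while `v` adds one vertex to
  -- the independent set.
  obtain ⟨v, hvW, hv⟩ := W.exists_min_image (fun v => ∑ u ∈ W with u = v ∨ H.Adj u v, p u) hW
  set A := W.filter (fun u => u = v ∨ H.Adj u v) with hA
  set W' := W.filter (fun u => ¬ (u = v ∨ H.Adj u v)) with hW'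
  have hvA : v ∈ A := by simp [hA, hvW]
  have hss : W' ⊂ W := Finset.filter_ssubset.2 ⟨v, hvW, by simp⟩
  obtain ⟨I, hIW, hI, hle⟩ := ih W' hss
  have hvI : v ∉ I := fun h => by simpa [hW'] using hIW h
  refine ⟨insert v I, ?_, ?_, ?_⟩
  · exact Finset.insert_subset hvW (hIW.trans hss.subset)
  · rw [Finset.coe_insert]
    refine Set.Pairwise.insert hI ?_
    intro b hb _
    have := hIW hb
    simp only [hW', Finset.mem_filter, not_or] at this
    exact ⟨fun h => this.2.2 h.symm, this.2.2⟩
  · have hpos : 0 < ∑ u ∈ A, p u := Finset.sum_pos (fun u _ => hp u) ⟨v, hvA⟩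
    rw [Finset.card_insert_of_notMem hvI, ← Finset.sum_filter_add_sum_filter_not W
      (fun u => u = v ∨ H.Adj u v)]
    have h1 : ∑ x ∈ A, p x / ∑ u ∈ W with u = x ∨ H.Adj u x, p u ≤ 1 := by
      calc _ ≤ ∑ x ∈ A, p x / ∑ u ∈ A, p u := by
            refine Finset.sum_le_sum fun x hx => ?_
            exact div_le_div_of_nonneg_left (hp x).le hpos (hv x (Finset.mem_filter.1 hx).1)
        _ = 1 := by rw [← Finset.sum_div, div_self hpos.ne']
    have h2 : ∑ x ∈ W', p x / ∑ u ∈ W with u = x ∨ H.Adj u x, p u ≤ I.card := by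
      refine le_trans (Finset.sum_le_sum fun x hx => ?_) hle
      refine div_le_div_of_nonneg_left (hp x).le
        (Finset.sum_pos (fun u _ => hp u) ⟨x, by simp [hx]⟩) ?_
      exact Finset.sum_le_sum_of_subset_of_nonneg
        (Finset.filter_subset_filter _ hss.subset) (fun u _ _ => (hp u).le)
    push_cast
    linarith

open Classical in
/-- In a reflexive digraph with vertex weights `p` some vertex of `W` has an in-neighborhood in `W`
of weight at least `p(W) / (2 α)`. -/
theorem exists_inWeight_ge {V : Type*} [Fintype V] (R : V → V → Prop) (hR : ∀ v, R v v) (p : V → ℝ)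
    (hp : ∀ v, 0 < p v) (W : Finset V) (hW : W.Nonempty) :
    ∃ v ∈ W, ∑ u ∈ W, p u ≤ 2 * ((SimpleGraph.fromRel R).indepNum : ℝ) * ∑ u ∈ W with R u v, p u := by
  set H := SimpleGraph.fromRel R
  obtain ⟨I, -, hI, hle⟩ := sum_div_closedNbhd_le_indepNum H p hp W
  have hα : (I.card : ℝ) ≤ H.indepNum := by exact_mod_cast hI.card_le_indepNum
  set α : ℝ := (H.indepNum : ℝ)
  set P := ∑ u ∈ W, p u
  have hP : 0 < P := Finset.sum_pos (fun u _ => hp u) hW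
  set S : V → ℝ := fun v => ∑ u ∈ W with u = v ∨ H.Adj u v, p u with hS
  have hSpos : ∀ v ∈ W, 0 < S v := fun v hv =>
    Finset.sum_pos (fun u _ => hp u) ⟨v, by simp [hv]⟩
  -- Cauchy–Schwarz for `p = √(p / S) · √(p S)`, combined with the Caro–Wei bound.
  have hCS : P ^ 2 ≤ α * ∑ v ∈ W, p v * S v := by
    have h := Finset.sum_sq_le_sum_mul_sum_of_sq_le_mul W (r := p) (f := fun v => p v / S v)
      (g := fun v => p v * S v) (fun v hv => (div_pos (hp v) (hSpos v hv)).le)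
      (fun v hv => (mul_pos (hp v) (hSpos v hv)).le)
      (fun v hv => by have := (hSpos v hv).ne'; exact le_of_eq (by field_simp))
    exact h.trans (mul_le_mul_of_nonneg_right (hle.trans hα)
      (Finset.sum_nonneg fun v hv => (mul_pos (hp v) (hSpos v hv)).le))
  -- Every pair counted on the left is an arc in at least one direction, and both directions carry
  -- the same weight `p v * p u`; hence the factor `2`.
  have hD : ∑ v ∈ W, p v * S v ≤ 2 * ∑ v ∈ W, p v * ∑ u ∈ W with R u v, p u := by
    have e1 : ∀ (Z : V → V → Prop) [∀ u v, Decidable (Z u v)], ∑ v ∈ W, p v * ∑ u ∈ W with Z u v, p u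
        = ∑ v ∈ W, ∑ u ∈ W, if Z u v then p v * p u else 0 := by
      intro Z _
      refine Finset.sum_congr rfl fun v _ => ?_
      rw [Finset.sum_filter, Finset.mul_sum]
      exact Finset.sum_congr rfl fun u _ => by split_ifs <;> simp
    have e2 : ∑ v ∈ W, ∑ u ∈ W, (if R u v then p v * p u else 0)
        = ∑ v ∈ W, ∑ u ∈ W, if R v u then p v * p u else 0 := by
      rw [Finset.sum_comm]
      refine Finset.sum_congr rfl fun v _ => Finset.sum_congr rfl fun u _ => ?_
      rw [mul_comm]
    simp only [hS]
    rw [e1 (fun u v => u = v ∨ H.Adj u v), e1, two_mul]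
    nth_rewrite 2 [e2]
    rw [← Finset.sum_add_distrib]
    refine Finset.sum_le_sum fun v _ => ?_
    rw [← Finset.sum_add_distrib]
    refine Finset.sum_le_sum fun u _ => ?_
    have hpp := (mul_pos (hp v) (hp u)).le
    by_cases h : u = v ∨ H.Adj u v
    · have : R u v ∨ R v u := by
        rcases h with rfl | h
        · exact Or.inl (hR _)
        · exact ((SimpleGraph.fromRel_adj R u v).1 h).2
      rcases this with h' | h' <;> simp only [h, h', if_true] <;> split_ifs <;> linarith
    · rw [if_neg h]; split_ifs <;> linarith
  by_contra! hcon
  have hα0 : 0 ≤ α := Nat.cast_nonneg _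
  have hlt : ∑ v ∈ W, p v * (2 * α * ∑ u ∈ W with R u v, p u) < ∑ v ∈ W, p v * P :=
    Finset.sum_lt_sum_of_nonempty hW fun v hv => mul_lt_mul_of_pos_left (hcon v hv) (hp v)
  have e3 : ∑ v ∈ W, p v * (2 * α * ∑ u ∈ W with R u v, p u)
      = α * (2 * ∑ v ∈ W, p v * ∑ u ∈ W with R u v, p u) := by
    rw [Finset.mul_sum, Finset.mul_sum]
    exact Finset.sum_congr rfl fun v _ => by ring
  rw [e3, ← Finset.sum_mul] at hlt
  have := mul_le_mul_of_nonneg_left hD hα0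
  nlinarith

open Classical in
/-- In a reflexive digraph with vertex weights `p ≥ β`, `∑ p(v) / p(N⁻(v))` is at most
`2 α (1 + ln (p(W) / β))`. -/
theorem sum_div_inWeight_le {V : Type*} [Fintype V] (R : V → V → Prop) (hR : ∀ v, R v v) (p : V → ℝ)
    {β : ℝ} (hβ : 0 < β) (hp : ∀ v, β ≤ p v) (W : Finset V) (hW : W.Nonempty) :
    ∑ v ∈ W, p v / ∑ u ∈ W with R u v, p u ≤
      2 * ((SimpleGraph.fromRel R).indepNum : ℝ) * (1 + Real.log ((∑ v ∈ W, p v) / β)) := by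
  have hp0 : ∀ v, 0 < p v := fun v => hβ.trans_le (hp v)
  have hα0 : (0 : ℝ) ≤ (SimpleGraph.fromRel R).indepNum := Nat.cast_nonneg _
  induction W using Finset.strongInduction with
  | H W ih =>
  -- Delete a vertex of heavy in-neighborhood and recurse. Its term is at most `2α p(v) / P`, and
  -- `p(v) / P = 1 - P'/P ≤ ln P - ln P'` telescopes. The last vertex, of weight at least `β`,
  -- accounts for the `1`.
  obtain ⟨v, hv, hle⟩ := exists_inWeight_ge R hR p hp0 W hW
  set α : ℝ := ((SimpleGraph.fromRel R).indepNum : ℝ)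
  set P := ∑ u ∈ W, p u with hPdef
  have hSpos : ∀ (X : Finset V), ∀ x ∈ X, 0 < ∑ u ∈ X with R u x, p u := fun X x hx =>
    Finset.sum_pos (fun u _ => hp0 u) ⟨x, by simp [hx, hR]⟩
  have hP : 0 < P := Finset.sum_pos (fun u _ => hp0 u) hW
  have hvS : p v / ∑ u ∈ W with R u v, p u ≤ 2 * α * (p v / P) := by
    rw [div_le_iff₀ (hSpos W v hv), mul_assoc, mul_comm (p v / P), ← mul_assoc, ← mul_div_assoc,
      le_div_iff₀ hP, mul_comm]
    exact mul_le_mul_of_nonneg_right hle (hp0 v).le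
  rw [← Finset.add_sum_erase W _ hv]
  have hPe : p v + ∑ u ∈ W.erase v, p u = P := Finset.add_sum_erase W p hv
  rcases (W.erase v).eq_empty_or_nonempty with he | hne
  · rw [he, Finset.sum_empty] at hPe ⊢
    rw [add_zero] at hPe ⊢
    refine hvS.trans (mul_le_mul_of_nonneg_left ?_ (by positivity))
    rw [hPe, div_self hP.ne']
    have : 0 ≤ Real.log (P / β) := Real.log_nonneg (by rw [le_div_iff₀ hβ, ← hPe]; linarith [hp v])
    linarith
  · have h1 := ih (W.erase v) (Finset.erase_ssubset hv) hne
    set P' := ∑ u ∈ W.erase v, p u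
    have hP' : 0 < P' := Finset.sum_pos (fun u _ => hp0 u) hne
    have h2 : ∑ x ∈ W.erase v, p x / ∑ u ∈ W with R u x, p u
        ≤ ∑ x ∈ W.erase v, p x / ∑ u ∈ W.erase v with R u x, p u := by
      refine Finset.sum_le_sum fun x hx => ?_
      refine div_le_div_of_nonneg_left (hp0 x).le (hSpos _ x hx) ?_
      exact Finset.sum_le_sum_of_subset_of_nonneg
        (Finset.filter_subset_filter _ (Finset.erase_subset _ _)) (fun u _ _ => (hp0 u).le)
    have h3 : p v / P ≤ Real.log (P / β) - Real.log (P' / β) := by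
      rw [Real.log_div hP.ne' hβ.ne', Real.log_div hP'.ne' hβ.ne']
      have h4 := Real.log_le_sub_one_of_pos (div_pos hP' hP)
      rw [Real.log_div hP'.ne' hP.ne'] at h4
      have : p v / P = 1 - P' / P := by rw [eq_sub_iff_add_eq, ← add_div, hPe, div_self hP.ne']
      linarith
    have := mul_le_mul_of_nonneg_left h3 (by positivity : 0 ≤ 2 * α)
    nlinarith

/-- `1 - ∏ (1 - p u) ≥ 1 - exp (-∑ p u)`. -/
theorem one_sub_exp_le_hitProb {V : Type*} {K : ℕ} (S : Finset V) (p : V → Fin K → ℝ) (i : Fin K)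
    (hp1 : ∀ u, p u i ≤ 1) : 1 - Real.exp (-∑ u ∈ S, p u i) ≤ hitProb S p i := by
  unfold hitProb
  rw [← Finset.sum_neg_distrib, Real.exp_sum]
  have : ∏ u ∈ S, (1 - p u i) ≤ ∏ u ∈ S, Real.exp (-p u i) :=
    Finset.prod_le_prod (fun u _ => sub_nonneg.2 (hp1 u))
      (fun u _ => by linarith [Real.add_one_le_exp (-p u i)])
  linarith

/-- `1 - exp (-x) ≥ min x 1 / 2` for `x ≥ 0`. -/
theorem half_min_le_one_sub_exp_neg {x : ℝ} (hx : 0 ≤ x) : min x 1 / 2 ≤ 1 - Real.exp (-x) := by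
  have h1 : Real.exp (-x) ≤ Real.exp (-min x 1) := Real.exp_le_exp.2 (neg_le_neg (min_le_left _ _))
  set y := min x 1
  have hy0 : 0 ≤ y := le_min hx zero_le_one
  have hy1 : y ≤ 1 := min_le_right _ _
  have h2 : Real.exp (-y) * (1 + y) ≤ 1 := by
    rw [Real.exp_neg, inv_mul_le_iff₀ (Real.exp_pos y), mul_one]
    linarith [Real.add_one_le_exp y]
  nlinarith [Real.exp_pos (-y)]

theorem arc_refl {V : Type*} (G : SimpleGraph V) (d ttl : V → ℕ) (v : V) : Arc G d ttl v v := by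
  simp [Arc]

theorem mem_inNbhd_self {V : Type*} [Fintype V] (G : SimpleGraph V) (d ttl : V → ℕ) (v : V) :
    v ∈ inNbhd G d ttl v := by
  simp [inNbhd, arc_refl]

/-- The sum over the agents of `p(i, v) / q(i, v)`. -/
theorem sum_div_hitProb_le {V : Type*} [Fintype V] [Nonempty V] {K : ℕ} (G : SimpleGraph V)
    (d ttl : V → ℕ) (p : V → Fin K → ℝ) (i : Fin K) {β : ℝ} (hβ : 0 < β) (hp : ∀ v, β ≤ p v i)
    (hp1 : ∀ v, p v i ≤ 1) :
    ∑ v, p v i / hitProb (inNbhd G d ttl v) p i ≤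
      2 * ∑ v, p v i +
        4 * alphaP G d ttl * (1 + Real.log (Fintype.card V / β)) := by
  classical
  have hp0 : ∀ v, 0 < p v i := fun v => hβ.trans_le (hp v)
  have h := sum_div_inWeight_le (Arc G d ttl) (arc_refl G d ttl) (fun v => p v i) hβ hp
    Finset.univ Finset.univ_nonempty
  have hsum : (0:ℝ) < ∑ v, p v i := Finset.sum_pos (fun v _ => hp0 v) Finset.univ_nonempty
  have hlog : Real.log ((∑ v, p v i) / β) ≤ Real.log (Fintype.card V / β) := by
    refine Real.log_le_log (div_pos hsum hβ) ?_
    gcongr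
    calc ∑ v, p v i ≤ ∑ _v : V, (1 : ℝ) := Finset.sum_le_sum fun v _ => hp1 v
      _ = _ := by simp
  have hterm : ∀ v, p v i / hitProb (inNbhd G d ttl v) p i
      ≤ 2 * p v i + 2 * (p v i / ∑ u with Arc G d ttl u v, p u i) := by
    intro v
    have hS : ∑ u ∈ inNbhd G d ttl v, p u i = ∑ u with Arc G d ttl u v, p u i := by
      unfold inNbhd
      exact Finset.sum_congr (by ext; simp) fun _ _ => rfl
    rw [← hS]
    set x := ∑ u ∈ inNbhd G d ttl v, p u i
    have hx : 0 < x := Finset.sum_pos (fun u _ => hp0 u) ⟨v, mem_inNbhd_self G d ttl v⟩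
    have hq := (half_min_le_one_sub_exp_neg hx.le).trans
      (one_sub_exp_le_hitProb (inNbhd G d ttl v) p i hp1)
    have hm : 0 < min x 1 := lt_min hx one_pos
    -- If the in-weight `x` is at least `1`, the ratio is at most `2p`; otherwise it is at most `2p
    -- / x`. The sum of the two covers both cases.
    calc p v i / hitProb (inNbhd G d ttl v) p i ≤ p v i / (min x 1 / 2) :=
          div_le_div_of_nonneg_left (hp0 v).le (by positivity) hq
      _ ≤ _ := by
        have := hp0 v
        have h0 : 0 ≤ p v i / x := (div_pos this hx).le
        rcases min_choice x 1 with h | h <;> rw [h]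
        · have : p v i / (x / 2) = 2 * (p v i / x) := by field_simp
          linarith
        · linarith
  calc _ ≤ ∑ v, (2 * p v i + 2 * (p v i / ∑ u with Arc G d ttl u v, p u i)) :=
        Finset.sum_le_sum fun v _ => hterm v
    _ = 2 * ∑ v, p v i + 2 * ∑ v, (p v i / ∑ u with Arc G d ttl u v, p u i) := by
        rw [Finset.sum_add_distrib, Finset.mul_sum, Finset.mul_sum]
    _ ≤ _ := by
        have hα0 : (0 : ℝ) ≤ (SimpleGraph.fromRel (Arc G d ttl)).indepNum := Nat.cast_nonneg _
        unfold alphaP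
        nlinarith [mul_le_mul_of_nonneg_left hlog hα0]

/-! ### Finite trajectories: conditioning as resampling of a coordinate. -/

section Trajectories

variable {B : Type*} {T : ℕ}

open Classical in
/-- Averaging a function of a trajectory over a resampled coordinate. -/
theorem sum_sum_update [Fintype B] (s : Fin T) (H : (Fin T → B) → ℝ) :
    ∑ a : Fin T → B, ∑ b, H (Function.update a s b) = Fintype.card B * ∑ a : Fin T → B, H a := by
  -- Exchanging the coordinate `a s` with the spare value `b` permutes the pairs `(a, b)`.
  have hinv : Function.Involutive
      (fun x : (Fin T → B) × B => (Function.update x.1 s x.2, x.1 s)) := by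
    rintro ⟨a, b⟩
    simp
  rw [← Fintype.sum_prod_type' (f := fun a b => H (Function.update a s b)),
    hinv.bijective.sum_comp (fun x : (Fin T → B) × B => H x.1), Fintype.sum_prod_type,
    Finset.mul_sum]
  simp

variable (π : Fin T → (Fin T → B) → B → ℝ)

/-- The weight of the first `n` rounds of a trajectory. -/
def prefixWeight (n : ℕ) (a : Fin T → B) : ℝ :=
  ∏ t ∈ Finset.univ.filter (fun t : Fin T => (t : ℕ) < n), π t a (a t)

variable {π}

theorem dependsOn_prefixWeight
    (hdep : ∀ t b, DependsOn (fun a => π t a b) {τ : Fin T | (τ : ℕ) < t}) (n : ℕ) :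
    DependsOn (prefixWeight π n) {τ : Fin T | (τ : ℕ) < n} := by
  intro a a' h
  refine Finset.prod_congr rfl fun t ht => ?_
  have ht' : (t : ℕ) < n := (Finset.mem_filter.1 ht).2
  rw [h t ht']
  exact hdep t (a' t) fun τ hτ => h τ (lt_trans hτ ht')

theorem prefixWeight_succ (s : Fin T) (a : Fin T → B) :
    prefixWeight π ((s : ℕ) + 1) a = π s a (a s) * prefixWeight π s a := by
  unfold prefixWeight
  rw [show (Finset.univ.filter fun t : Fin T => (t : ℕ) < s + 1)
      = insert s (Finset.univ.filter fun t : Fin T => (t : ℕ) < s) by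
    ext t
    simp only [Finset.mem_filter, Finset.mem_univ, true_and, Finset.mem_insert, Fin.ext_iff]
    omega]
  exact Finset.prod_insert (by simp)

/-- Everything except the factor of round `s` ignores coordinate `s`, so resampling that coordinate
integrates the kernel `π s`. The cardinality appears because the sum runs over whole trajectories,
including the coordinates not yet weighted. -/
theorem card_mul_sum_prefixWeight_succ [Fintype B]
    (hdep : ∀ t b, DependsOn (fun a => π t a b) {τ : Fin T | (τ : ℕ) < t}) (s : Fin T)
    {f : (Fin T → B) → B → ℝ} (hf : ∀ b, DependsOn (fun a => f a b) {τ : Fin T | (τ : ℕ) < s}) :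
    Fintype.card B * ∑ a, prefixWeight π ((s : ℕ) + 1) a * f a (a s) =
      ∑ a, prefixWeight π s a * ∑ b, π s a b * f a b := by
  classical
  rw [← sum_sum_update s]
  refine Finset.sum_congr rfl fun a _ => ?_
  rw [Finset.mul_sum]
  refine Finset.sum_congr rfl fun b _ => ?_
  have hu : ∀ τ ∈ {τ : Fin T | (τ : ℕ) < s}, Function.update a s b τ = a τ := fun τ hτ =>
    Function.update_of_ne (fun h => by subst h; exact lt_irrefl _ (Set.mem_ofPred_eq ▸ hτ)) _ _
  have h1 := dependsOn_prefixWeight hdep s hu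
  have h2 := hdep s b hu
  have h3 := hf b hu
  simp only at h2 h3
  rw [prefixWeight_succ, h1, Function.update_self, h2, h3]
  ring

/-- A round beyond the prefix contributes a free factor `card B` when it is unweighted and the total
mass `1` when it is weighted. This compares prefix sums with expectations under the full law. -/
theorem sum_prefixWeight_eq [Fintype B]
    (hdep : ∀ t b, DependsOn (fun a => π t a b) {τ : Fin T | (τ : ℕ) < t})
    (hsum : ∀ t a, ∑ b, π t a b = 1) (m : ℕ) :
    ∀ (n : ℕ), n + m = T → ∀ {F : (Fin T → B) → ℝ}, DependsOn F {τ : Fin T | (τ : ℕ) < n} →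
      ∑ a, prefixWeight π n a * F a = (Fintype.card B : ℝ) ^ m * ∑ a, prefixWeight π T a * F a := by
  induction m with
  | zero => intro n hn F _; simp only [add_zero] at hn; subst hn; simp
  | succ m ih =>
    intro n hn F hF
    have hnT : n < T := by omega
    have hstep := card_mul_sum_prefixWeight_succ hdep ⟨n, hnT⟩ (f := fun a _ => F a)
      (fun _ => hF)
    simp only [← Finset.sum_mul, hsum, one_mul] at hstep
    rw [← hstep, ih (n + 1) (by omega) (fun a a' h => hF fun τ hτ => h τ (Nat.lt_succ_of_lt hτ)),
      pow_succ]
    ring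

/-- Resampling the action of round `s`, given the past. -/
theorem sum_prod_mul_eq [Fintype B] [Nonempty B]
    (hdep : ∀ t b, DependsOn (fun a => π t a b) {τ : Fin T | (τ : ℕ) < t})
    (hsum : ∀ t a, ∑ b, π t a b = 1) (s : Fin T) {f : (Fin T → B) → B → ℝ}
    (hf : ∀ b, DependsOn (fun a => f a b) {τ : Fin T | (τ : ℕ) < s}) :
    ∑ a, (∏ t, π t a (a t)) * f a (a s) = ∑ a, (∏ t, π t a (a t)) * ∑ b, π s a b * f a b := by
  have hT : ∀ a, ∏ t, π t a (a t) = prefixWeight π T a := fun a => by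
    unfold prefixWeight
    rw [Finset.filter_true_of_mem (fun t _ => t.2)]
  simp only [hT]
  have h1 := card_mul_sum_prefixWeight_succ hdep s hf
  rw [sum_prefixWeight_eq hdep hsum (T - (s + 1)) (s + 1) (by omega) ?_,
    sum_prefixWeight_eq hdep hsum (T - s) s (by omega) ?_, ← mul_assoc, ← pow_succ',
    show T - ((s : ℕ) + 1) + 1 = T - s by omega] at h1
  · exact mul_left_cancel₀ (pow_ne_zero _ (by exact_mod_cast Fintype.card_ne_zero)) h1
  · intro a a' h
    exact Finset.sum_congr rfl fun b _ => congrArg₂ (· * ·) (hdep s b h) (hf b h)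
  · intro a a' h
    have hs : a s = a' s := h s (Nat.lt_succ_self _)
    simp only
    rw [hs]
    exact hf (a' s) fun τ hτ => h τ (Nat.lt_succ_of_lt hτ)

end Trajectories

/-! ### Effect of clipping on the action distribution. -/

section ActionProb

variable {K : ℕ} {δ : ℝ} {w : Fin K → ℝ}

theorem clipped_pos (hδ : 0 < δ) (hK : 0 < K) (w : Fin K → ℝ) (i : Fin K) : 0 < clipped δ w i :=
  lt_max_of_lt_right (by positivity)

theorem sum_clipped_pos (hδ : 0 < δ) (hK : 0 < K) (w : Fin K → ℝ) : 0 < ∑ i, clipped δ w i :=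
  Finset.sum_pos (fun i _ => clipped_pos hδ hK w i) ⟨⟨0, hK⟩, Finset.mem_univ _⟩

theorem actionProb_pos (hδ : 0 < δ) (hK : 0 < K) (w : Fin K → ℝ) (i : Fin K) :
    0 < actionProb δ w i :=
  div_pos (clipped_pos hδ hK w i) (sum_clipped_pos hδ hK w)

theorem sum_actionProb (hδ : 0 < δ) (hK : 0 < K) (w : Fin K → ℝ) : ∑ i, actionProb δ w i = 1 := by
  unfold actionProb
  rw [← Finset.sum_div, div_self (sum_clipped_pos hδ hK w).ne']

theorem actionProb_le_one (hδ : 0 < δ) (hK : 0 < K) (w : Fin K → ℝ) (i : Fin K) :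
    actionProb δ w i ≤ 1 := by
  rw [← sum_actionProb hδ hK w]
  exact Finset.single_le_sum (fun j _ => (actionProb_pos hδ hK w j).le) (Finset.mem_univ i)

theorem sum_clipped_le (hδ : 0 < δ) (hK : 0 < K) (hw : ∀ i, 0 ≤ w i) :
    ∑ i, clipped δ w i ≤ 1 + δ := by
  have hW : 0 ≤ ∑ j, w j := Finset.sum_nonneg fun j _ => hw j
  calc ∑ i, clipped δ w i ≤ ∑ i, (w i / ∑ j, w j + δ / K) :=
        Finset.sum_le_sum fun i _ => max_le_add_of_nonneg (div_nonneg (hw i) hW) (by positivity)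
    _ = (∑ j, w j) / (∑ j, w j) + δ := by
        rw [Finset.sum_add_distrib, ← Finset.sum_div]
        simp only [Finset.sum_const, Finset.card_univ, Fintype.card_fin, nsmul_eq_mul]
        field_simp
    _ ≤ 1 + δ := by gcongr; exact div_self_le_one _

theorem one_le_sum_clipped (hw : 0 < ∑ j, w j) : 1 ≤ ∑ i, clipped δ w i := by
  calc (1 : ℝ) = ∑ i, w i / ∑ j, w j := by rw [← Finset.sum_div, div_self hw.ne']
    _ ≤ _ := Finset.sum_le_sum fun i _ => le_max_left _ _

/-- Clipping adds at most `δ` to the total mass, so normalizing loses at most a factor `1 + δ`. All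
later error terms in `δ` come from here. -/
theorem clipped_div_le_actionProb (hδ : 0 < δ) (hK : 0 < K) (hw : ∀ i, 0 ≤ w i) (i : Fin K) :
    clipped δ w i / (1 + δ) ≤ actionProb δ w i :=
  div_le_div_of_nonneg_left (clipped_pos hδ hK w i).le (sum_clipped_pos hδ hK w)
    (sum_clipped_le hδ hK hw)

theorem actionProb_le_clipped (hδ : 0 < δ) (hK : 0 < K) (hw : 0 < ∑ j, w j) (i : Fin K) :
    actionProb δ w i ≤ clipped δ w i :=
  div_le_self (clipped_pos hδ hK w i).le (one_le_sum_clipped hw)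

theorem le_actionProb (hδ : 0 < δ) (hδ1 : δ ≤ 1) (hK : 0 < K) (hw : ∀ i, 0 ≤ w i) (i : Fin K) :
    δ / (2 * K) ≤ actionProb δ w i := by
  refine le_trans ?_ (clipped_div_le_actionProb hδ hK hw i)
  rw [mul_comm, ← div_div]
  exact div_le_div₀ (clipped_pos hδ hK w i).le (le_max_right _ _) (by linarith) (by linarith)

theorem actionProb_const_one (hK : 0 < K) (hδ1 : δ ≤ 1) (i : Fin K) :
    actionProb δ (fun _ : Fin K => (1 : ℝ)) i = 1 / K := by
  have hK' : (0 : ℝ) < K := by exact_mod_cast hK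
  have : ∀ i, clipped δ (fun _ : Fin K => (1 : ℝ)) i = 1 / K := fun i => by
    simp only [clipped, Finset.sum_const, Finset.card_univ, Fintype.card_fin, nsmul_eq_mul, mul_one]
    exact max_eq_left (by gcongr)
  simp only [actionProb, this, Finset.sum_const, Finset.card_univ, Fintype.card_fin, nsmul_eq_mul]
  field_simp

end ActionProb

/-! ### Which past rounds determine the state. -/

section Run

variable {V : Type*} [Fintype V] {K T : ℕ} (G : SimpleGraph V) (d ttl : V → ℕ) (δ : ℝ)
  (ℓ : ℕ → Fin K → ℝ)

theorem run_zero (a : Fin T → V → Fin K) (v : V) :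
    run G d ttl δ ℓ a 0 v = AgentState.fresh K (firstStage K (d v)) := by
  rw [run]

/-- The event that some in-neighbor of `v` plays `i` in round `s`. -/
def Hit (a : Fin T → V → Fin K) (s : ℕ) (v : V) (i : Fin K) : Prop :=
  ∃ u ∈ inNbhd G d ttl v, ∃ h : s < T, a ⟨s, h⟩ u = i

/-- The probability `q_s(i, v)`. -/
def qProb (a : Fin T → V → Fin K) (s : ℕ) (v : V) (i : Fin K) : ℝ :=
  hitProb (inNbhd G d ttl v) (playProb G d ttl δ ℓ a s) i

/-- The loss estimate of agent `v` at the end of round `t`. -/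
def estAt (a : Fin T → V → Fin K) (t : ℕ) (v : V) : Fin K → ℝ :=
  lossEst (d v) (run G d ttl δ ℓ a t v).clock (ℓ (t - d v)) (qProb G d ttl δ ℓ a (t - d v) v)
    (Hit G d ttl a (t - d v) v)

/-- The value `Q_t(v)`. -/
def qAt (a : Fin T → V → Fin K) (t : ℕ) (v : V) : ℝ :=
  qTerm (d v) (run G d ttl δ ℓ a t v).clock (playProb G d ttl δ ℓ a (t - d v) v)
    (qProb G d ttl δ ℓ a (t - d v) v)

theorem run_succ (a : Fin T → V → Fin K) (t : ℕ) (v : V) :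
    run G d ttl δ ℓ a (t + 1) v = (run G d ttl δ ℓ a t v).next δ (d v)
      (estAt G d ttl δ ℓ a t v) (qAt G d ttl δ ℓ a t v) := by
  rw [run]
  rfl

theorem clock_le (a : Fin T → V → Fin K) (t : ℕ) (v : V) :
    (run G d ttl δ ℓ a t v).clock ≤ t + 1 := by
  induction t with
  | zero => rw [run_zero]; rfl
  | succ t ih =>
    rw [run_succ, AgentState.next]
    split_ifs
    · simp [AgentState.fresh]
    · simpa using ih

/-- The state of an agent with delay `d` at the beginning of round `t` depends on the rounds
`τ < t - d` only. -/
theorem dependsOn_run (t : ℕ) : ∀ v, DependsOn (fun a : Fin T → V → Fin K =>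
    run G d ttl δ ℓ a t v) {τ : Fin T | (τ : ℕ) + d v < t} := by
  induction t using Nat.strong_induction_on with
  | _ t ih =>
  intro v a a' h
  rcases t with _ | t
  · simp only [run_zero]
  simp only [run_succ]
  have h1 : run G d ttl δ ℓ a t v = run G d ttl δ ℓ a' t v :=
    ih t (Nat.lt_succ_self t) v fun τ hτ => h τ (lt_trans hτ (Nat.lt_succ_self t))
  have h2 : playProb G d ttl δ ℓ a (t - d v) = playProb G d ttl δ ℓ a' (t - d v) := by
    funext u
    unfold playProb
    have : run G d ttl δ ℓ a (t - d v) u = run G d ttl δ ℓ a' (t - d v) u :=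
      -- The neighbor's own delay `d u` is harmless: `τ + d u < t - d v` already gives `τ + d v < t
      -- + 1`.
      ih (t - d v) (by omega) u fun τ (hτ : (τ : ℕ) + d u < t - d v) =>
        h τ (show (τ : ℕ) + d v < t + 1 by omega)
    rw [this]
  have h3 : qAt G d ttl δ ℓ a t v = qAt G d ttl δ ℓ a' t v := by
    unfold qAt qProb
    rw [h1, h2]
  have h4 : estAt G d ttl δ ℓ a t v = estAt G d ttl δ ℓ a' t v := by
    unfold estAt qProb
    rw [h1, h2]
    funext i
    unfold lossEst
    -- The hits are read only when `d v < clock ≤ t + 1`. Then `t - d v` is a true difference and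
    -- round `t - d v` is an admissible coordinate for the state at `t + 1`.
    by_cases hc : d v < (run G d ttl δ ℓ a' t v).clock
    · have hdt := hc.trans_le (clock_le G d ttl δ ℓ a' t v)
      have hhit : Hit G d ttl a (t - d v) v i ↔ Hit G d ttl a' (t - d v) v i := by
        unfold Hit
        refine exists_congr fun u => and_congr_right fun _ => exists_congr fun hs => ?_
        rw [h ⟨t - d v, hs⟩ (show t - d v + d v < t + 1 by omega)]
      simp only [if_pos hc]
      congr 1
      by_cases hh : Hit G d ttl a' (t - d v) v i
      · rw [if_pos hh, if_pos (hhit.2 hh)]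
      · rw [if_neg hh, if_neg (mt hhit.1 hh)]
    · simp only [if_neg hc]
  rw [h1, h3, h4]

theorem dependsOn_run_sub (t : ℕ) (u : V) : DependsOn (fun a : Fin T → V → Fin K =>
    run G d ttl δ ℓ a t u) {τ : Fin T | (τ : ℕ) < t - d u} := fun _ _ h =>
  dependsOn_run G d ttl δ ℓ t u fun τ hτ =>
    h τ (show (τ : ℕ) < t - d u from Nat.lt_sub_of_add_lt hτ)

theorem dependsOn_playProb (t : ℕ) : DependsOn (fun a : Fin T → V → Fin K =>
    playProb G d ttl δ ℓ a t) {τ : Fin T | (τ : ℕ) < t} := fun a a' h => by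
  funext u i
  have : run G d ttl δ ℓ a t u = run G d ttl δ ℓ a' t u :=
    dependsOn_run G d ttl δ ℓ t u fun τ hτ => h τ (lt_of_le_of_lt (Nat.le_add_right _ _) hτ)
  simp only [playProb, this]

theorem dependsOn_qProb (t : ℕ) (v : V) : DependsOn (fun a : Fin T → V → Fin K =>
    qProb G d ttl δ ℓ a t v) {τ : Fin T | (τ : ℕ) < t} := fun a a' h => by
  have : playProb G d ttl δ ℓ a t = playProb G d ttl δ ℓ a' t :=
    dependsOn_playProb G d ttl δ ℓ t h
  unfold qProb
  simp only [this]

/-- The restart decision, and not just the state, is determined before the round `t - d v` whose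
actions enter the estimate. Conditioning on not restarting therefore does not bias the estimate. -/
theorem dependsOn_qAt (t : ℕ) (v : V) : DependsOn (fun a : Fin T → V → Fin K =>
    qAt G d ttl δ ℓ a t v) {τ : Fin T | (τ : ℕ) < t - d v} := fun a a' h => by
  have h1 := dependsOn_run_sub G d ttl δ ℓ t v h
  have h2 := dependsOn_playProb G d ttl δ ℓ (t - d v) h
  have h3 := dependsOn_qProb G d ttl δ ℓ (t - d v) v h
  simp only at h1 h2 h3 ⊢
  unfold qAt
  rw [h1, h2, h3]

end Run

/-! ### Expectation over the agents' draws. -/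

section Expect

variable {V : Type*} [Fintype V] {K T : ℕ} {G : SimpleGraph V} {d ttl : V → ℕ} {δ : ℝ}
  {ℓ : ℕ → Fin K → ℝ}

theorem playProb_pos (hδ : 0 < δ) (hK : 0 < K) (a : Fin T → V → Fin K) (t : ℕ) (v : V)
    (i : Fin K) : 0 < playProb G d ttl δ ℓ a t v i := actionProb_pos hδ hK _ i

theorem sum_playProb (hδ : 0 < δ) (hK : 0 < K) (a : Fin T → V → Fin K) (t : ℕ) (v : V) :
    ∑ i, playProb G d ttl δ ℓ a t v i = 1 := sum_actionProb hδ hK _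

theorem trajProb_nonneg (hδ : 0 < δ) (hK : 0 < K) (a : Fin T → V → Fin K) :
    0 ≤ trajProb G d ttl δ ℓ a :=
  Finset.prod_nonneg fun _ _ => Finset.prod_nonneg fun _ _ => (playProb_pos hδ hK _ _ _ _).le

theorem expect_mono (hδ : 0 < δ) (hK : 0 < K) {f g : (Fin T → V → Fin K) → ℝ}
    (h : ∀ a, f a ≤ g a) : expect G d ttl δ ℓ f ≤ expect G d ttl δ ℓ g :=
  Finset.sum_le_sum fun a _ => mul_le_mul_of_nonneg_left (h a) (trajProb_nonneg hδ hK a)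

theorem expect_add (f g : (Fin T → V → Fin K) → ℝ) :
    expect G d ttl δ ℓ (fun a => f a + g a) = expect G d ttl δ ℓ f + expect G d ttl δ ℓ g := by
  simp only [expect, mul_add, Finset.sum_add_distrib]

theorem expect_sub (f g : (Fin T → V → Fin K) → ℝ) :
    expect G d ttl δ ℓ (fun a => f a - g a) = expect G d ttl δ ℓ f - expect G d ttl δ ℓ g := by
  simp only [expect, mul_sub, Finset.sum_sub_distrib]

theorem expect_const_mul (c : ℝ) (f : (Fin T → V → Fin K) → ℝ) :
    expect G d ttl δ ℓ (fun a => c * f a) = c * expect G d ttl δ ℓ f := by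
  simp only [expect, Finset.mul_sum]
  exact Finset.sum_congr rfl fun a _ => by ring

theorem expect_sum {ι : Type*} (s : Finset ι) (f : ι → (Fin T → V → Fin K) → ℝ) :
    expect G d ttl δ ℓ (fun a => ∑ i ∈ s, f i a) = ∑ i ∈ s, expect G d ttl δ ℓ (f i) := by
  simp only [expect, Finset.mul_sum]
  exact Finset.sum_comm

open Classical in
theorem sum_prod_mul_prod (p g : V → Fin K → ℝ) :
    ∑ b : V → Fin K, (∏ v, p v (b v)) * ∏ v, g v (b v) = ∏ v, ∑ i, p v i * g v i := by
  rw [Fintype.prod_sum]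
  simp only [Finset.prod_mul_distrib]

open Classical in
theorem expect_resample (hδ : 0 < δ) (hK : 0 < K) (s : Fin T)
    {f : (Fin T → V → Fin K) → (V → Fin K) → ℝ}
    (hf : ∀ b, DependsOn (fun a => f a b) {τ : Fin T | (τ : ℕ) < s}) :
    expect G d ttl δ ℓ (fun a => f a (a s)) = expect G d ttl δ ℓ (fun a =>
      ∑ b : V → Fin K, (∏ v, playProb G d ttl δ ℓ a s v (b v)) * f a b) := by
  have : Nonempty (Fin K) := ⟨⟨0, hK⟩⟩
  refine sum_prod_mul_eq (π := fun t a b => ∏ v, playProb G d ttl δ ℓ a t v (b v)) ?_ ?_ s hf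
  · intro t b a a' h
    have := dependsOn_playProb G d ttl δ ℓ t h
    simp only at this ⊢
    rw [this]
  · intro t a
    have := sum_prod_mul_prod (fun v => playProb G d ttl δ ℓ a t v) (fun _ _ => 1)
    simp only [Finset.prod_const_one, mul_one, sum_playProb hδ hK] at this
    exact this

theorem sum_trajProb (hδ : 0 < δ) (hK : 0 < K) :
    expect G d ttl δ ℓ (fun _ : Fin T → V → Fin K => 1) = 1 := by
  classical
  have : Nonempty (Fin K) := ⟨⟨0, hK⟩⟩
  have h := sum_prefixWeight_eq (T := T) (B := V → Fin K)
    (π := fun t a b => ∏ v, playProb G d ttl δ ℓ a t v (b v)) ?_ ?_ T 0 (by omega) (F := fun _ => 1)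
    (fun _ _ _ => rfl)
  · have hT : ∀ a, trajProb G d ttl δ ℓ a
      = prefixWeight (fun (t : Fin T) a b => ∏ v, playProb G d ttl δ ℓ a t v (b v)) T a := fun a => by
      unfold prefixWeight trajProb
      rw [Finset.filter_true_of_mem (fun t _ => t.2)]
    simp only [expect, hT]
    simp only [prefixWeight, Nat.not_lt_zero, Finset.filter_false, Finset.prod_empty,
      mul_one, Finset.sum_const, Finset.card_univ, Fintype.card_pi, Finset.prod_const,
      Fintype.card_fin, nsmul_eq_mul] at h ⊢
    refine mul_left_cancel₀ ?_ (h.symm.trans ?_)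
    · push_cast; positivity
    · push_cast; ring
  · intro t b a a' h
    have := dependsOn_playProb G d ttl δ ℓ t h
    simp only at this ⊢
    rw [this]
  · intro t a
    have := sum_prod_mul_prod (fun v => playProb G d ttl δ ℓ a t v) (fun _ _ => 1)
    simp only [Finset.prod_const_one, mul_one, sum_playProb hδ hK] at this
    exact this

theorem expect_const (hδ : 0 < δ) (hK : 0 < K) (c : ℝ) :
    expect G d ttl δ ℓ (fun _ : Fin T → V → Fin K => c) = c := by
  have := expect_const_mul (G := G) (d := d) (ttl := ttl) (δ := δ) (ℓ := ℓ) (T := T) c (fun _ => 1)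
  rw [sum_trajProb hδ hK] at this
  simpa using this

/-- The expected value of a function of the action of agent `v` in round `s`. -/
theorem expect_play (hδ : 0 < δ) (hK : 0 < K) (s : Fin T) (v : V) (x : Fin K → ℝ) :
    expect G d ttl δ ℓ (fun a => x (a s v)) =
      expect G d ttl δ ℓ (fun a : Fin T → V → Fin K => ∑ i, playProb G d ttl δ ℓ a s v i * x i) := by
  classical
  rw [expect_resample hδ hK s (f := fun _ b => x (b v)) (fun b _ _ _ => rfl)]
  congr 1
  funext a
  have h := sum_prod_mul_prod (fun v => playProb G d ttl δ ℓ a s v)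
    (fun u i => if u = v then x i else 1)
  have h1 : ∀ b : V → Fin K, ∏ u, (if u = v then x (b u) else 1) = x (b v) := fun b => by
    rw [Finset.prod_ite_eq' Finset.univ v (fun u => x (b u))]; simp
  simp only [h1] at h
  rw [h, Finset.prod_eq_single v]
  · simp
  · intro u _ hu
    simp [hu, sum_playProb hδ hK]
  · simp

open Classical in
/-- The event `B_s(i, v)` has conditional probability `q_s(i, v)`. -/
theorem expect_hit (hδ : 0 < δ) (hK : 0 < K) {s : ℕ} (hs : s < T) (v : V) (i : Fin K)
    {X : (Fin T → V → Fin K) → ℝ} (hX : DependsOn X {τ : Fin T | (τ : ℕ) < s}) :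
    expect G d ttl δ ℓ (fun a => X a * if Hit G d ttl a s v i then 1 else 0) =
      expect G d ttl δ ℓ (fun a => X a * qProb G d ttl δ ℓ a s v i) := by
  -- Writing the complement of a hit as a product over the agents lets the independence within a
  -- round factorize the sum.
  have h0 : ∀ a : Fin T → V → Fin K, (if Hit G d ttl a s v i then (1 : ℝ) else 0) =
      1 - ∏ u, if u ∈ inNbhd G d ttl v ∧ a ⟨s, hs⟩ u = i then 0 else 1 := by
    intro a
    by_cases h : Hit G d ttl a s v i
    · obtain ⟨u, hu, _, hi⟩ := h
      rw [if_pos ⟨u, hu, hs, hi⟩, Finset.prod_eq_zero (i := u) (Finset.mem_univ u) (by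
        rw [if_pos ⟨hu, hi⟩]), sub_zero]
    · rw [if_neg h, Finset.prod_eq_one, sub_self]
      intro u _
      exact if_neg fun ⟨hu, hi⟩ => h ⟨u, hu, hs, hi⟩
  simp only [h0]
  rw [expect_resample hδ hK ⟨s, hs⟩
    (f := fun a b => X a * (1 - ∏ u, if u ∈ inNbhd G d ttl v ∧ b u = i then 0 else 1))
    (fun b a a' h => by simp only; rw [hX h])]
  congr 1
  funext a
  have h1 := sum_prod_mul_prod (fun u => playProb G d ttl δ ℓ a s u) (fun _ _ => 1)
  have h2 := sum_prod_mul_prod (fun u => playProb G d ttl δ ℓ a s u)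
    (fun u j => if u ∈ inNbhd G d ttl v ∧ j = i then 0 else 1)
  simp only [Finset.prod_const_one, mul_one, sum_playProb hδ hK] at h1
  have h3 : ∀ u, ∑ j, playProb G d ttl δ ℓ a s u j *
      (if u ∈ inNbhd G d ttl v ∧ j = i then 0 else 1) =
      if u ∈ inNbhd G d ttl v then 1 - playProb G d ttl δ ℓ a s u i else 1 := by
    intro u
    by_cases hu : u ∈ inNbhd G d ttl v
    · simp only [hu, true_and, if_true]
      have hsum := sum_playProb (G := G) (d := d) (ttl := ttl) (ℓ := ℓ) hδ hK a s u
      rw [← Finset.sum_erase_add _ _ (Finset.mem_univ i)] at hsum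
      rw [eq_sub_iff_add_eq, ← Finset.sum_erase_add _ _ (Finset.mem_univ i)]
      simp only [if_true, mul_zero, add_zero]
      refine Eq.trans ?_ hsum
      congr 1
      exact Finset.sum_congr rfl fun j hj => by rw [if_neg (Finset.ne_of_mem_erase hj), mul_one]
    · simp [hu, sum_playProb hδ hK]
  simp only [h3] at h2
  rw [Finset.prod_ite, Finset.prod_const_one, mul_one, Finset.filter_mem_eq_inter,
    Finset.univ_inter] at h2
  unfold qProb hitProb
  rw [← h2]
  calc _ = X a * (∑ b : V → Fin K, ∏ u, playProb G d ttl δ ℓ a s u (b u)) - X a *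
        ∑ b : V → Fin K, (∏ u, playProb G d ttl δ ℓ a s u (b u)) *
          ∏ u, if u ∈ inNbhd G d ttl v ∧ b u = i then 0 else 1 := by
        rw [Finset.mul_sum, Finset.mul_sum, ← Finset.sum_sub_distrib]
        exact Finset.sum_congr rfl fun b _ => by ring
    _ = _ := by rw [h1, mul_sub, mul_one]

end Expect

/-! ### Learning rates and stage scales. -/

section Rates

/-- The regret scale `√(ln K · 2 ^ r)` of stage `r`. -/
def stageScale (K r : ℕ) : ℝ := √(Real.log K * 2 ^ r)

theorem half_le_log {K : ℕ} (hK : 2 ≤ K) : 1 / 2 ≤ Real.log K := by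
  have h2 : (2 : ℝ) ≤ K := by exact_mod_cast hK
  linarith [Real.log_two_gt_d9, Real.log_le_log two_pos h2]

variable {K : ℕ} (hK : 2 ≤ K)
include hK

theorem scale_pos (d : ℕ) : 0 < scale K d := by
  have : (0 : ℝ) < K := by exact_mod_cast (by omega : 0 < K)
  unfold scale
  positivity

theorem stageScale_pos (r : ℕ) : 0 < stageScale K r := by
  have := half_le_log hK
  exact Real.sqrt_pos.2 (by positivity)

theorem stageScale_sq (r : ℕ) : stageScale K r ^ 2 = Real.log K * 2 ^ r := by
  have := half_le_log hK
  exact Real.sq_sqrt (by positivity)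

theorem etaStage_eq (d r : ℕ) : etaStage K d r = Real.log K / stageScale K r := by
  have hl := half_le_log hK
  have h0 : 0 < Real.log K := by linarith
  unfold etaStage gammaStage
  rw [mul_div_cancel_left₀ _ (scale_pos hK d).ne', eq_div_iff (stageScale_pos hK r).ne', stageScale,
    ← Real.sqrt_mul (by positivity), show Real.log K / 2 ^ r * (Real.log K * 2 ^ r)
      = Real.log K ^ 2 by field_simp, Real.sqrt_sq h0.le]

theorem etaStage_pos (d r : ℕ) : 0 < etaStage K d r := by
  rw [etaStage_eq hK]
  have := half_le_log hK
  exact div_pos (by linarith) (stageScale_pos hK r)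

theorem etaStage_mul_two_pow (d r : ℕ) : etaStage K d r * 2 ^ r = stageScale K r := by
  rw [etaStage_eq hK, div_mul_eq_mul_div, div_eq_iff (stageScale_pos hK r).ne',
    ← stageScale_sq hK r, sq]

theorem one_div_etaStage (d r : ℕ) : 1 / etaStage K d r = stageScale K r / Real.log K := by
  rw [etaStage_eq hK, one_div_div]

/-- Consecutive scales have ratio `√2 ≥ 4/3`, and `4` is the sum of the geometric series with ratio
`3/4`. -/
theorem sum_stageScale_le (R : ℕ) : ∑ r ∈ Finset.range (R + 1), stageScale K r ≤
    4 * stageScale K R := by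
  induction R with
  | zero =>
    rw [zero_add, Finset.sum_range_one]
    linarith [stageScale_pos hK 0]
  | succ R ih =>
    rw [Finset.sum_range_succ]
    have h1 := stageScale_sq hK R
    have h2 := stageScale_sq hK (R + 1)
    have h3 := stageScale_pos hK (R + 1)
    have h4 : stageScale K R ≤ 3 / 4 * stageScale K (R + 1) := by
      refine abs_le_of_sq_le_sq' ?_ (by positivity) |>.2
      rw [pow_succ (2 : ℝ) R] at h2
      nlinarith
    linarith

theorem stageScale_mono {r s : ℕ} (h : r ≤ s) : stageScale K r ≤ stageScale K s := by
  have := half_le_log hK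
  refine Real.sqrt_le_sqrt (mul_le_mul_of_nonneg_left ?_ (by linarith))
  exact pow_le_pow_right₀ one_le_two h

theorem exp_le_scale (d : ℕ) : K * Real.exp 1 ≤ scale K d := by
  unfold scale
  have : (0 : ℝ) ≤ d := Nat.cast_nonneg d
  have : (0:ℝ) ≤ K * Real.exp 1 := by positivity
  nlinarith

theorem one_le_log_mul_scale (d : ℕ) : 1 ≤ Real.log K * scale K d := by
  have h1 := half_le_log hK
  have h2 := exp_le_scale hK d
  have h3 := Real.add_one_le_exp (1 : ℝ)
  have h4 : (2 : ℝ) ≤ K := by exact_mod_cast hK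
  have h5 : 4 ≤ scale K d := by nlinarith
  nlinarith

theorem two_pow_firstStage (d : ℕ) : Real.log K * scale K d ^ 2 ≤ 2 ^ firstStage K d ∧
    (2 : ℝ) ^ firstStage K d ≤ 2 * (Real.log K * scale K d ^ 2) := by
  have h1 := half_le_log hK
  have h2 := scale_pos hK d
  have h0 : 0 < Real.log K := by linarith
  have hx : Real.logb 2 (Real.log K) + 2 * Real.logb 2 (scale K d)
      = Real.logb 2 (Real.log K * scale K d ^ 2) := by
    rw [Real.logb_mul h0.ne' (by positivity), Real.logb_pow]
    norm_num
  have hpos : 0 < Real.log K * scale K d ^ 2 := by positivity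
  have h3 : 1 ≤ Real.log K * scale K d ^ 2 := by
    have := one_le_log_mul_scale hK d
    have h5 := exp_le_scale hK d
    have h6 := Real.add_one_le_exp (1 : ℝ)
    have h4 : (2 : ℝ) ≤ K := by exact_mod_cast hK
    nlinarith
  have hx0 : 0 ≤ Real.logb 2 (Real.log K * scale K d ^ 2) := Real.logb_nonneg one_lt_two h3
  have e : Real.log K * scale K d ^ 2 = (2 : ℝ) ^ Real.logb 2 (Real.log K * scale K d ^ 2) :=
    (Real.rpow_logb two_pos (by norm_num) hpos).symm
  unfold firstStage
  rw [hx, ← Real.rpow_natCast 2 ⌈_⌉₊]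
  constructor
  · nth_rewrite 1 [e]
    exact Real.rpow_le_rpow_of_exponent_le one_le_two (Nat.le_ceil _)
  · nth_rewrite 2 [e]
    rw [← Real.rpow_one_add' two_pos.le (by linarith)]
    exact Real.rpow_le_rpow_of_exponent_le one_le_two
      ((Nat.ceil_lt_add_one hx0).le.trans (by linarith))

/-- The initial stage is chosen exactly for this: `η ≤ 1 / (K e (d + 1))` throughout, which limits
the growth of the probabilities over one delay. -/
theorem etaStage_mul_scale_le (d : ℕ) {r : ℕ} (hr : firstStage K d ≤ r) :
    etaStage K d r * scale K d ≤ 1 := by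
  have h0 := half_le_log hK
  have h1 := (two_pow_firstStage hK d).1.trans (pow_le_pow_right₀ one_le_two hr)
  rw [etaStage_eq hK, div_mul_eq_mul_div, div_le_one (stageScale_pos hK r)]
  refine Real.le_sqrt_of_sq_le ?_
  nlinarith

end Rates

/-! ### One agent along a fixed trajectory. -/

/-- `exp (-x) ≤ 1 - x + x² / 2` for `x ≥ 0`. -/
theorem exp_neg_le_quadratic {x : ℝ} (hx : 0 ≤ x) : Real.exp (-x) ≤ 1 - x + x ^ 2 / 2 := by
  have h := Real.quadratic_le_exp_of_nonneg hx
  rw [Real.exp_neg, inv_le_iff_one_le_mul₀ (Real.exp_pos x)]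
  have h1 : 0 ≤ 1 - x + x ^ 2 / 2 := by nlinarith [sq_nonneg (x - 1)]
  -- `(1 - x + x²/2)(1 + x + x²/2) = 1 + x⁴/4`.
  have := mul_le_mul_of_nonneg_left h h1
  nlinarith [sq_nonneg (x ^ 2)]

/-- The evolution of the state of one agent with delay `d`, driven by loss estimates `est`, with
`q s` the probabilities used as importance weights for round `s`. -/
structure AgentPath (K : ℕ) (δ : ℝ) (d : ℕ) where
  st : ℕ → AgentState K
  est : ℕ → Fin K → ℝ
  q : ℕ → Fin K → ℝ
  Q : ℕ → ℝ
  st_zero : st 0 = AgentState.fresh K (firstStage K d)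
  st_succ : ∀ t, st (t + 1) = (st t).next δ d (est t) (Q t)
  Q_eq : ∀ t, Q t = qTerm d (st t).clock (actionProb δ (st (t - d)).weight) (q (t - d))
  est_eq_zero : ∀ t, (st t).clock ≤ d → ∀ i, est t i = 0
  est_nonneg : ∀ t i, 0 ≤ est t i
  est_le : ∀ t i, est t i ≤ 1 / q (t - d) i
  prob_le : ∀ t i, actionProb δ (st t).weight i ≤ q t i

namespace AgentPath

variable {K d : ℕ} {δ : ℝ} (A : AgentPath K δ d)

/-- The distribution of the agent in round `t`. -/
def p (t : ℕ) (i : Fin K) : ℝ := actionProb δ (A.st t).weight i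

/-- The learning rate in round `t`. -/
def eta (t : ℕ) : ℝ := etaStage K d (A.st t).stage

/-- The agent does not restart at the end of round `t`. -/
def Cont (t : ℕ) : Prop := (A.st t).total + A.Q t ≤ 2 ^ (A.st t).stage

theorem st_succ_of_cont {t : ℕ} (h : A.Cont t) : A.st (t + 1) =
    { weight := fun i => A.p t i * Real.exp (-(A.eta t) * A.est t i)
      stage := (A.st t).stage
      clock := (A.st t).clock + 1
      total := (A.st t).total + A.Q t } := by
  rw [A.st_succ, AgentState.next, if_neg (not_lt.2 h)]
  rfl

theorem st_succ_of_not_cont {t : ℕ} (h : ¬ A.Cont t) :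
    A.st (t + 1) = AgentState.fresh K ((A.st t).stage + 1) := by
  rw [A.st_succ, AgentState.next, if_pos (not_le.1 h)]

theorem clock_le (t : ℕ) : (A.st t).clock ≤ t + 1 := by
  induction t with
  | zero => rw [A.st_zero]; rfl
  | succ t ih =>
    by_cases h : A.Cont t
    · rw [A.st_succ_of_cont h]
      simpa using ih
    · rw [A.st_succ_of_not_cont h]
      simp [AgentState.fresh]

theorem firstStage_le (t : ℕ) : firstStage K d ≤ (A.st t).stage := by
  induction t with
  | zero => rw [A.st_zero]; rfl
  | succ t ih =>
    by_cases h : A.Cont t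
    · rw [A.st_succ_of_cont h]; exact ih
    · rw [A.st_succ_of_not_cont h]; exact ih.trans (Nat.le_succ _)

theorem stage_mono : Monotone fun t => (A.st t).stage := by
  refine monotone_nat_of_le_succ fun t => ?_
  by_cases h : A.Cont t
  · rw [A.st_succ_of_cont h]
  · rw [A.st_succ_of_not_cont h]; exact Nat.le_succ _

/-- If the current stage has lasted more than `j` rounds, the agent did not restart in the last `j`
rounds. -/
theorem cont_of_lt_clock (s j : ℕ) (h : j < (A.st (s + j)).clock) :
    (∀ t, s ≤ t → t < s + j → A.Cont t) ∧ (A.st s).clock + j = (A.st (s + j)).clock := by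
  induction j with
  | zero => exact ⟨fun t h1 h2 => absurd h2 (by omega), rfl⟩
  | succ j ih =>
    have hc : A.Cont (s + j) := by
      by_contra hc
      rw [← add_assoc, A.st_succ_of_not_cont hc] at h
      simp [AgentState.fresh] at h
    rw [← add_assoc, A.st_succ_of_cont hc] at h ⊢
    simp only [add_lt_add_iff_right] at h
    obtain ⟨h1, h2⟩ := ih h
    refine ⟨fun t ht1 ht2 => ?_, by simp only; omega⟩
    rcases (Nat.lt_succ_iff_lt_or_eq.1 ht2) with ht | rfl
    · exact h1 t ht1 ht
    · exact hc

theorem eta_pos (hK : 2 ≤ K) (t : ℕ) : 0 < A.eta t := etaStage_pos hK d _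

theorem eta_mul_scale_le (hK : 2 ≤ K) (t : ℕ) : A.eta t * scale K d ≤ 1 :=
  etaStage_mul_scale_le hK d (A.firstStage_le t)

theorem p_add_le_of_growth {c : ℝ} (hc : 0 ≤ c) (s j : ℕ)
    (h : ∀ t, s ≤ t → t < s + j → ∀ i, A.p (t + 1) i ≤ c * A.p t i) (i : Fin K) :
    A.p (s + j) i ≤ c ^ j * A.p s i := by
  induction j with
  | zero => simp
  | succ j ih =>
    rw [← add_assoc, pow_succ', mul_assoc]
    exact (h (s + j) (by omega) (by omega) i).trans
      (mul_le_mul_of_nonneg_left (ih fun t h1 h2 => h t h1 (by omega)) hc)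

/-- Since `clock ≤ t + 1`, the condition `d < clock` forces `d ≤ t`. On such rounds `t ↦ t - d` is
injective, so each `s` is used at most once. -/
theorem sum_shift_le {g : ℕ → ℝ} (hg : ∀ s, 0 ≤ g s) (n : ℕ) :
    ∑ t ∈ Finset.range n, (if d < (A.st t).clock then g (t - d) else 0) ≤
      ∑ s ∈ Finset.range n, g s := by
  have key : ∀ n, ∑ t ∈ Finset.range n, (if d < (A.st t).clock then g (t - d) else 0) ≤
      ∑ s ∈ Finset.range (n - d), g s := by
    intro n
    induction n with
    | zero => simp
    | succ n ih =>
      rw [Finset.sum_range_succ]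
      rcases Nat.lt_or_ge n d with h | h
      · have : ¬ d < (A.st n).clock := by have := A.clock_le n; omega
        rw [if_neg this, add_zero, show n + 1 - d = 0 by omega]
        rwa [show n - d = 0 by omega] at ih
      · rw [show n + 1 - d = n - d + 1 by omega, Finset.sum_range_succ]
        refine add_le_add ih ?_
        split_ifs
        exacts [le_rfl, hg _]
  exact (key n).trans (Finset.sum_le_sum_of_subset_of_nonneg
    (Finset.range_mono (Nat.sub_le n d)) fun s _ _ => hg s)

open Classical in
-- A stage wastes at most its first `d` rounds, before any feedback is available, and the round in
-- which it restarts. In the induction, `min d (clock - 1)` counts the wasted rounds of the current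
-- stage.
theorem card_uncovered_le (n : ℕ) :
    ∑ t ∈ Finset.range n, (if d < (A.st t).clock ∧ A.Cont t then (0 : ℝ) else 1) ≤
      (d + 1) * (((A.st n).stage : ℝ) - firstStage K d + 1) := by
  have key : ∀ n, ∑ t ∈ Finset.range n, (if d < (A.st t).clock ∧ A.Cont t then (0 : ℝ) else 1) ≤
      (d + 1) * (((A.st n).stage : ℝ) - firstStage K d) + (min d ((A.st n).clock - 1) : ℕ) := by
    intro n
    induction n with
    | zero => rw [A.st_zero]; simp [AgentState.fresh]
    | succ n ih =>
      rw [Finset.sum_range_succ]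
      by_cases h : A.Cont n
      · rw [A.st_succ_of_cont h]
        simp only [h, and_true, Nat.add_sub_cancel]
        have hd : min d ((A.st n).clock - 1) ≤ min d (A.st n).clock := by omega
        split_ifs with hc
        · have : ((min d ((A.st n).clock - 1) : ℕ) : ℝ) ≤ (min d (A.st n).clock : ℕ) := by
            exact_mod_cast hd
          linarith
        · have hpos : 1 ≤ (A.st n).clock := by
            rcases n with _ | n
            · rw [A.st_zero]; rfl
            · by_cases h' : A.Cont n
              · rw [A.st_succ_of_cont h']; simp
              · rw [A.st_succ_of_not_cont h']; rfl
          have : min d ((A.st n).clock - 1) + 1 ≤ min d (A.st n).clock := by omega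
          have : ((min d ((A.st n).clock - 1) : ℕ) : ℝ) + 1 ≤ (min d (A.st n).clock : ℕ) := by
            exact_mod_cast this
          linarith
      · rw [A.st_succ_of_not_cont h]
        simp only [h, and_false, if_false, AgentState.fresh]
        have : ((min d ((A.st n).clock - 1) : ℕ) : ℝ) ≤ d := by exact_mod_cast min_le_left _ _
        have : (0 : ℝ) ≤ (min d (1 - 1) : ℕ) := Nat.cast_nonneg _
        rw [Nat.cast_succ]
        linarith
  refine (key n).trans ?_
  have : ((min d ((A.st n).clock - 1) : ℕ) : ℝ) ≤ d := by exact_mod_cast min_le_left _ _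
  linarith

section Pos

variable (hδ : 0 < δ) (hK : 2 ≤ K)
include hδ hK

theorem p_pos (t : ℕ) (i : Fin K) : 0 < A.p t i := actionProb_pos hδ (by omega) _ i

theorem sum_p (t : ℕ) : ∑ i, A.p t i = 1 := sum_actionProb hδ (by omega) _

theorem p_le_one (t : ℕ) (i : Fin K) : A.p t i ≤ 1 := actionProb_le_one hδ (by omega) _ i

theorem q_pos (t : ℕ) (i : Fin K) : 0 < A.q t i := (A.p_pos hδ hK t i).trans_le (A.prob_le t i)

theorem p_div_q_le_one (t : ℕ) (i : Fin K) : A.p t i / A.q t i ≤ 1 :=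
  div_le_one_of_le₀ (A.prob_le t i) (A.q_pos hδ hK t i).le

theorem weight_pos (t : ℕ) (i : Fin K) : 0 < (A.st t).weight i := by
  rcases t with _ | t
  · rw [A.st_zero]; exact one_pos
  · by_cases h : A.Cont t
    · rw [A.st_succ_of_cont h]
      exact mul_pos (A.p_pos hδ hK t i) (Real.exp_pos _)
    · rw [A.st_succ_of_not_cont h]; exact one_pos

theorem sum_weight_pos (t : ℕ) : 0 < ∑ i, (A.st t).weight i :=
  Finset.sum_pos (fun i _ => A.weight_pos hδ hK t i) ⟨⟨0, by omega⟩, Finset.mem_univ _⟩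

theorem Q_nonneg (t : ℕ) : 0 ≤ A.Q t := by
  rw [A.Q_eq, qTerm]
  split_ifs
  · have : 0 ≤ ∑ i, actionProb δ (A.st (t - d)).weight i / A.q (t - d) i :=
      Finset.sum_nonneg fun i _ => (div_pos (A.p_pos hδ hK _ i) (A.q_pos hδ hK _ i)).le
    positivity
  · exact le_rfl

theorem sum_weight_succ_le_one {t : ℕ} (h : A.Cont t) :
    ∑ i, (A.st (t + 1)).weight i ≤ 1 := by
  rw [A.st_succ_of_cont h, ← A.sum_p hδ hK t]
  refine Finset.sum_le_sum fun i _ => mul_le_of_le_one_right (A.p_pos hδ hK t i).le ?_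
  rw [Real.exp_le_one_iff, neg_mul, neg_nonpos]
  exact mul_nonneg (A.eta_pos hK t).le (A.est_nonneg t i)

theorem weight_succ_ge {t : ℕ} (h : A.Cont t) (i : Fin K) :
    A.p t i * (1 - A.eta t * A.est t i) ≤ (A.st (t + 1)).weight i := by
  rw [A.st_succ_of_cont h]
  refine mul_le_mul_of_nonneg_left ?_ (A.p_pos hδ hK t i).le
  linarith [Real.add_one_le_exp (-(A.eta t) * A.est t i)]

theorem weight_succ_le {t : ℕ} (h : A.Cont t) (i : Fin K) :
    (A.st (t + 1)).weight i ≤ A.p t i := by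
  rw [A.st_succ_of_cont h]
  refine mul_le_of_le_one_right (A.p_pos hδ hK t i).le ?_
  rw [Real.exp_le_one_iff, neg_mul, neg_nonpos]
  exact mul_nonneg (A.eta_pos hK t).le (A.est_nonneg t i)

theorem normalized_weight_div_le (t : ℕ) (i : Fin K) :
    (A.st t).weight i / (∑ j, (A.st t).weight j) / (1 + δ) ≤ A.p t i := by
  refine le_trans ?_ (clipped_div_le_actionProb hδ (by omega : 0 < K)
    (fun j => (A.weight_pos hδ hK t j).le) i)
  exact div_le_div_of_nonneg_right (le_max_left _ _) (by linarith)

/-- The probabilities decrease slowly. -/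
theorem p_sub_p_succ_le {t : ℕ} (h : A.Cont t) (i : Fin K) :
    A.p t i - A.p (t + 1) i ≤ A.p t i * (A.eta t * A.est t i + δ) := by
  have hp := A.p_pos hδ hK t i
  set x := A.eta t * A.est t i with hx
  have hx0 : 0 ≤ x := mul_nonneg (A.eta_pos hK t).le (A.est_nonneg t i)
  -- For `x ≤ 1`, the new probability is at least `p (1 - x) / (1 + δ) ≥ p (1 - x)(1 - δ)`. For `x >
  -- 1` the claimed bound exceeds `p` itself.
  rcases le_or_gt x 1 with h1 | h1
  · have h2 := A.normalized_weight_div_le hδ hK (t + 1) i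
    have hw := A.weight_pos hδ hK (t + 1) i
    have h3 : A.p t i * (1 - x) ≤ (A.st (t + 1)).weight i / ∑ j, (A.st (t + 1)).weight j :=
      (A.weight_succ_ge hδ hK h i).trans (by
        rw [le_div_iff₀ (A.sum_weight_pos hδ hK (t + 1))]
        exact mul_le_of_le_one_right hw.le (A.sum_weight_succ_le_one hδ hK h))
    have h4 : A.p t i * (1 - x) ≤ A.p (t + 1) i * (1 + δ) := by
      rw [div_le_iff₀ (by linarith)] at h2
      linarith
    have h5 := mul_le_mul_of_nonneg_left h4 hδ.le
    have h6 : A.p t i * (1 - x) * (1 - δ) ≤ A.p (t + 1) i := by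
      have h7 : 0 ≤ A.p t i * (1 - x) := mul_nonneg hp.le (by linarith)
      have h8 : 0 < A.p (t + 1) i := A.p_pos hδ hK _ _
      rcases le_or_gt δ 1 with h9 | h9
      · nlinarith [mul_le_mul_of_nonneg_left h4 (by linarith : 0 ≤ 1 - δ), sq_nonneg δ]
      · nlinarith
    nlinarith [mul_nonneg hp.le (mul_nonneg hx0 hδ.le)]
  · have := A.p_pos hδ hK (t + 1) i
    nlinarith [mul_pos hp hδ]

open Classical in
theorem p_sub_p_add_le (s j : ℕ) (h : ∀ t, s ≤ t → t < s + j → A.Cont t) (i : Fin K) :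
    A.p s i - A.p (s + j) i ≤ ∑ t ∈ Finset.Ico s (s + j),
      if A.Cont t then A.p t i * (A.eta t * A.est t i + δ) else 0 := by
  induction j with
  | zero => simp
  | succ j ih =>
    rw [← add_assoc, Finset.sum_Ico_succ_top (by omega)]
    have hc := h (s + j) (by omega) (by omega)
    rw [if_pos hc]
    have := A.p_sub_p_succ_le hδ hK hc i
    have := ih fun t h1 h2 => h t h1 (by omega)
    linarith

/-- The probabilities grow slowly. -/
theorem p_succ_le (hδ1 : δ * d ≤ 1) (hd : 0 < d) (t : ℕ) (h : A.Cont t) (i : Fin K) :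
    A.p (t + 1) i ≤ Real.exp (1 / d) * A.p t i := by
  induction t using Nat.strong_induction_on generalizing i with
  | _ t ih =>
  have hd' : (0 : ℝ) < d := by exact_mod_cast hd
  have hK' : (0 : ℝ) < K := by exact_mod_cast (by omega : 0 < K)
  have hexp : 1 + 1 / (d : ℝ) ≤ Real.exp (1 / d) := by linarith [Real.add_one_le_exp (1 / (d : ℝ))]
  have hp := A.p_pos hδ hK t
  -- By induction `p` grew by at most `(e^(1/d))^d = e` since round `t - d`. Each `p_t · est` is
  -- thus at most `e q · (1 / q) = e`, and `η K e ≤ 1 / (d + 1)`.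
  have hsum : A.eta t * ∑ j, A.p t j * A.est t j ≤ 1 / (d + 1) := by
    rcases le_or_gt (A.st t).clock d with hc | hc
    · simp only [A.est_eq_zero t hc, mul_zero, Finset.sum_const_zero]
      positivity
    · have hdt : d ≤ t := Nat.lt_succ_iff.1 (hc.trans_le (A.clock_le t))
      obtain ⟨s, rfl⟩ := Nat.exists_eq_add_of_le' hdt
      obtain ⟨hcont, -⟩ := A.cont_of_lt_clock s d hc
      have hg : ∀ j, A.p (s + d) j ≤ Real.exp 1 * A.p s j := fun j => by
        have := A.p_add_le_of_growth (Real.exp_pos (1 / (d : ℝ))).le s d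
          (fun t h1 h2 i => ih t h2 (hcont t h1 h2) i) j
        rwa [← Real.exp_nat_mul, mul_one_div_cancel hd'.ne'] at this
      have hle : ∑ j, A.p (s + d) j * A.est (s + d) j ≤ K * Real.exp 1 := by
        calc _ ≤ ∑ _j : Fin K, Real.exp 1 := by
              refine Finset.sum_le_sum fun j _ => ?_
              have he := A.est_le (s + d) j
              rw [Nat.add_sub_cancel] at he
              have hq := A.q_pos hδ hK s j
              calc _ ≤ (Real.exp 1 * A.q s j) * (1 / A.q s j) :=
                    mul_le_mul ((hg j).trans (mul_le_mul_of_nonneg_left (A.prob_le s j)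
                      (Real.exp_pos 1).le)) he (A.est_nonneg _ j) (by positivity)
                _ = _ := by field_simp
          _ = _ := by simp
      have h1 := A.eta_mul_scale_le hK (s + d)
      have h2 := mul_le_mul_of_nonneg_left hle (A.eta_pos hK (s + d)).le
      rw [le_div_iff₀ (by positivity)]
      unfold scale at h1
      nlinarith
  have hW : (d : ℝ) / (d + 1) ≤ ∑ j, (A.st (t + 1)).weight j := by
    calc (d : ℝ) / (d + 1) = 1 - 1 / (d + 1) := by field_simp; ring
      _ ≤ 1 - A.eta t * ∑ j, A.p t j * A.est t j := by linarith
      _ = ∑ j, A.p t j * (1 - A.eta t * A.est t j) := by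
        nth_rewrite 1 [← A.sum_p hδ hK t]
        rw [Finset.mul_sum, ← Finset.sum_sub_distrib]
        exact Finset.sum_congr rfl fun j _ => by ring
      _ ≤ _ := Finset.sum_le_sum fun j _ => A.weight_succ_ge hδ hK h j
  -- The two arguments of the clipping maximum: the normalized weight grows by at most `(d + 1) / d
  -- = 1 + 1/d`, and the floor `δ / K` is at most `(1 + δ) p_t`.
  refine (actionProb_le_clipped hδ (by omega) (A.sum_weight_pos hδ hK (t + 1)) i).trans
    (max_le ?_ ?_)
  · calc _ ≤ A.p t i / (d / (d + 1)) :=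
          div_le_div₀ (hp i).le (A.weight_succ_le hδ hK h i) (by positivity) hW
      _ = (1 + 1 / d) * A.p t i := by field_simp
      _ ≤ _ := mul_le_mul_of_nonneg_right hexp (hp i).le
  · have h1 : δ / K / (1 + δ) ≤ A.p t i :=
      le_trans (div_le_div_of_nonneg_right (le_max_right _ _) (by linarith))
        (clipped_div_le_actionProb hδ (by omega : 0 < K)
          (fun j => (A.weight_pos hδ hK t j).le) i)
    rw [div_le_iff₀ (by linarith)] at h1
    have h2 : 1 + δ ≤ Real.exp (1 / d) := by
      have : δ ≤ 1 / d := by rwa [le_div_iff₀ hd']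
      linarith
    calc δ / K ≤ A.p t i * (1 + δ) := h1
      _ ≤ _ := by rw [mul_comm]; exact mul_le_mul_of_nonneg_right h2 (hp i).le

theorem p_le_exp_mul (hδ1 : δ * d ≤ 1) {t : ℕ} (hc : d < (A.st t).clock) (i : Fin K) :
    A.p t i ≤ Real.exp 1 * A.p (t - d) i := by
  -- Without delay there is nothing to iterate, and the per-round factor `e^(1/d)` is available only
  -- for positive `d`.
  rcases Nat.eq_zero_or_pos d with h0 | hd
  · rw [show t - d = t by omega]
    have := Real.add_one_le_exp (1 : ℝ)
    have := A.p_pos hδ hK t i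
    nlinarith
  have hdt : d ≤ t := Nat.lt_succ_iff.1 (hc.trans_le (A.clock_le t))
  obtain ⟨s, rfl⟩ := Nat.exists_eq_add_of_le' hdt
  obtain ⟨hcont, -⟩ := A.cont_of_lt_clock s d hc
  have := A.p_add_le_of_growth (Real.exp_pos (1 / (d : ℝ))).le s d
    (fun t h1 h2 i => A.p_succ_le hδ hK hδ1 hd t (hcont t h1 h2) i) i
  rw [← Real.exp_nat_mul, mul_one_div_cancel (by positivity)] at this
  rwa [Nat.add_sub_cancel]

/-- One step of exponential weights. -/
theorem sum_p_mul_est_sub_le {t : ℕ} (h : A.Cont t) (k : Fin K) :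
    ∑ i, A.p t i * A.est t i - A.est t k ≤
      1 / A.eta t * (Real.log (A.p (t + 1) k) - Real.log (A.p t k) + δ) +
        A.eta t / 2 * ∑ i, A.p t i * A.est t i ^ 2 := by
  have hη := A.eta_pos hK t
  have hp := A.p_pos hδ hK t k
  have hw := A.weight_pos hδ hK (t + 1) k
  have hW := A.sum_weight_pos hδ hK (t + 1)
  -- The clipped probabilities themselves serve as potential: clipping and renormalizing lower `ln
  -- p(k)` by at most `ln(1 + δ) ≤ δ`.
  have h1 : Real.log (A.p t k) - A.eta t * A.est t k
      - Real.log (∑ j, (A.st (t + 1)).weight j) - Real.log (1 + δ) ≤ Real.log (A.p (t + 1) k) := by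
    have := Real.log_le_log (by positivity) (A.normalized_weight_div_le hδ hK (t + 1) k)
    rw [Real.log_div (by positivity) (by positivity), Real.log_div hw.ne' hW.ne'] at this
    have e : Real.log ((A.st (t + 1)).weight k) = Real.log (A.p t k) - A.eta t * A.est t k := by
      rw [A.st_succ_of_cont h]
      simp only
      rw [Real.log_mul hp.ne' (Real.exp_pos _).ne', Real.log_exp]
      ring
    linarith
  have h2 : Real.log (1 + δ) ≤ δ := by linarith [Real.log_le_sub_one_of_pos (by linarith : 0 < 1 + δ)]
  have h3 : Real.log (∑ j, (A.st (t + 1)).weight j) ≤ -(A.eta t * ∑ i, A.p t i * A.est t i)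
      + A.eta t ^ 2 / 2 * ∑ i, A.p t i * A.est t i ^ 2 := by
    refine (Real.log_le_sub_one_of_pos hW).trans ?_
    rw [sub_le_iff_le_add]
    calc ∑ j, (A.st (t + 1)).weight j ≤ ∑ j, A.p t j * (1 - A.eta t * A.est t j
          + (A.eta t * A.est t j) ^ 2 / 2) := by
          rw [A.st_succ_of_cont h]
          refine Finset.sum_le_sum fun j _ => ?_
          simp only
          refine mul_le_mul_of_nonneg_left ?_ (A.p_pos hδ hK t j).le
          rw [neg_mul]
          exact exp_neg_le_quadratic (mul_nonneg hη.le (A.est_nonneg t j))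
      _ = -(A.eta t * ∑ i, A.p t i * A.est t i)
      + A.eta t ^ 2 / 2 * ∑ i, A.p t i * A.est t i ^ 2 + 1 := by
        conv_rhs => rw [← A.sum_p hδ hK t]
        rw [Finset.mul_sum, Finset.mul_sum, ← Finset.sum_neg_distrib, ← Finset.sum_add_distrib,
          ← Finset.sum_add_distrib]
        exact Finset.sum_congr rfl fun j _ => by ring
  have h4 : A.eta t * (∑ i, A.p t i * A.est t i - A.est t k) ≤
      Real.log (A.p (t + 1) k) - Real.log (A.p t k) + δ
        + A.eta t ^ 2 / 2 * ∑ i, A.p t i * A.est t i ^ 2 := by linarith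
  rw [← mul_le_mul_iff_right₀ hη]
  refine h4.trans (le_of_eq ?_)
  field_simp

open Classical in
-- The potential `(1/η) ln p(k)` telescopes within a stage. A restart resets it to `-(ln K)/η =
-- -stageScale`, which the summand of the new stage pays for.
theorem sum_cont_le_potential (hδ1 : δ ≤ 1) (n : ℕ) (k : Fin K) :
    ∑ t ∈ Finset.range n, (if A.Cont t then ∑ i, A.p t i * A.est t i - A.est t k else 0) ≤
      1 / A.eta n * Real.log (A.p n k) + ∑ r ∈ Finset.range ((A.st n).stage + 1), stageScale K r +
      δ * ∑ t ∈ Finset.range n, 1 / A.eta t +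
      ∑ t ∈ Finset.range n, (if A.Cont t then A.eta t / 2 * ∑ i, A.p t i * A.est t i ^ 2 else 0) := by
  have hfresh : ∀ (t r : ℕ), A.st t = AgentState.fresh K r →
      1 / A.eta t * Real.log (A.p t k) = - stageScale K r := fun t r h => by
    have hl := half_le_log hK
    have : A.p t k = 1 / K := by
      unfold p
      rw [h]
      exact actionProb_const_one (by omega) hδ1 k
    rw [this, one_div (K : ℝ), Real.log_inv, eta, one_div_etaStage hK, h]
    simp only [AgentState.fresh]
    field_simp
  induction n with
  | zero =>
    simp only [Finset.range_zero, Finset.sum_empty, mul_zero, add_zero]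
    rw [hfresh 0 _ A.st_zero, A.st_zero]
    simp only [AgentState.fresh]
    rw [Finset.sum_range_succ]
    have : 0 ≤ ∑ r ∈ Finset.range (firstStage K d), stageScale K r :=
      Finset.sum_nonneg fun r _ => (stageScale_pos hK r).le
    linarith
  | succ n ih =>
    simp only [Finset.sum_range_succ _ n]
    have hη := one_div_pos.2 (A.eta_pos hK n)
    by_cases h : A.Cont n
    · simp only [if_pos h]
      have h1 := A.sum_p_mul_est_sub_le hδ hK h k
      have h2 : A.eta (n + 1) = A.eta n := by unfold eta; rw [A.st_succ_of_cont h]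
      have h3 : (A.st (n + 1)).stage = (A.st n).stage := by rw [A.st_succ_of_cont h]
      rw [h2, h3]
      linarith
    · simp only [if_neg h, add_zero]
      rw [hfresh (n + 1) _ (A.st_succ_of_not_cont h), A.st_succ_of_not_cont h]
      simp only [AgentState.fresh]
      rw [Finset.sum_range_succ _ ((A.st n).stage + 1)]
      -- At a restart the old potential is nonpositive and can be dropped.
      have h1 : 1 / A.eta n * Real.log (A.p n k) ≤ 0 := mul_nonpos_of_nonneg_of_nonpos hη.le
        (Real.log_nonpos (A.p_pos hδ hK n k).le (A.p_le_one hδ hK n k))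
      have := mul_pos hδ hη
      linarith

open Classical in
/-- The regret of exponential weights over the rounds without restart. -/
theorem sum_cont_le (hδ1 : δ ≤ 1) (n : ℕ) (hn : δ * n ≤ 1) (k : Fin K) :
    ∑ t ∈ Finset.range n, (if A.Cont t then ∑ i, A.p t i * A.est t i - A.est t k else 0) ≤
      6 * stageScale K (A.st n).stage +
      ∑ t ∈ Finset.range n, (if A.Cont t then A.eta t / 2 * ∑ i, A.p t i * A.est t i ^ 2 else 0) := by
  have h0 := A.sum_cont_le_potential hδ hK hδ1 n k
  have h1 : 1 / A.eta n * Real.log (A.p n k) ≤ 0 :=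
    mul_nonpos_of_nonneg_of_nonpos (one_div_pos.2 (A.eta_pos hK n)).le
      (Real.log_nonpos (A.p_pos hδ hK n k).le (A.p_le_one hδ hK n k))
  have h2 := sum_stageScale_le hK (A.st n).stage
  have hS := stageScale_pos hK (A.st n).stage
  -- `1/η = stageScale / ln K ≤ 2 stageScale` as `ln K ≥ 1/2`. With `δ n ≤ 1` this gives the `2` in
  -- `6 = 4 + 2`.
  have h3 : ∑ t ∈ Finset.range n, 1 / A.eta t ≤ n * (2 * stageScale K (A.st n).stage) := by
    calc _ ≤ ∑ _t ∈ Finset.range n, 2 * stageScale K (A.st n).stage := by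
          refine Finset.sum_le_sum fun t ht => ?_
          rw [eta, one_div_etaStage hK]
          have hl := half_le_log hK
          have hm := stageScale_mono hK (A.stage_mono (Finset.mem_range.1 ht).le)
          have := stageScale_pos hK (A.st t).stage
          rw [div_le_iff₀ (by linarith)]
          simp only at hm
          nlinarith
      _ = _ := by simp
  have h4 : δ * ∑ t ∈ Finset.range n, 1 / A.eta t ≤ 2 * stageScale K (A.st n).stage := by
    have := mul_le_mul_of_nonneg_left h3 hδ.le
    nlinarith
  linarith

theorem total_le (t : ℕ) : 0 ≤ (A.st t).total ∧ (A.st t).total ≤ 2 ^ (A.st t).stage := by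
  induction t with
  | zero => rw [A.st_zero]; simp [AgentState.fresh]
  | succ t ih =>
    by_cases h : A.Cont t
    · rw [A.st_succ_of_cont h]
      exact ⟨add_nonneg ih.1 (A.Q_nonneg hδ hK t), h⟩
    · rw [A.st_succ_of_not_cont h]; simp [AgentState.fresh]

open Classical in
-- Before its restart, stage `r` accumulates `∑ Q ≤ 2^r` at constant rate, and `η_r 2^r = stageScale
-- K r`; the scales then sum geometrically.
theorem sum_eta_mul_Q_le (n : ℕ) :
    ∑ t ∈ Finset.range n, (if A.Cont t then A.eta t * A.Q t else 0) ≤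
      4 * stageScale K (A.st n).stage := by
  have key : ∀ n, ∑ t ∈ Finset.range n, (if A.Cont t then A.eta t * A.Q t else 0) ≤
      ∑ r ∈ Finset.range (A.st n).stage, stageScale K r + A.eta n * (A.st n).total := by
    intro n
    induction n with
    | zero =>
      rw [A.st_zero]
      simp only [Finset.range_zero, Finset.sum_empty, AgentState.fresh, mul_zero, add_zero]
      exact Finset.sum_nonneg fun r _ => (stageScale_pos hK r).le
    | succ n ih =>
      rw [Finset.sum_range_succ]
      by_cases h : A.Cont n
      · have h2 : A.eta (n + 1) = A.eta n := by unfold eta; rw [A.st_succ_of_cont h]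
        rw [if_pos h, h2, A.st_succ_of_cont h]
        simp only
        linarith
      · rw [if_neg h, A.st_succ_of_not_cont h]
        simp only [AgentState.fresh, mul_zero, add_zero]
        rw [Finset.sum_range_succ, ← etaStage_mul_two_pow hK d (A.st n).stage]
        have := mul_le_mul_of_nonneg_left (A.total_le hδ hK n).2 (A.eta_pos hK n).le
        have e : A.eta n = etaStage K d (A.st n).stage := rfl
        rw [e] at this ih
        linarith
  refine (key n).trans (le_trans ?_ (sum_stageScale_le hK (A.st n).stage))
  rw [Finset.sum_range_succ, ← etaStage_mul_two_pow hK d (A.st n).stage]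
  have := mul_le_mul_of_nonneg_left (A.total_le hδ hK n).2 (A.eta_pos hK n).le
  unfold eta at this ⊢
  linarith

/-- A stage beyond the initial one was entered because the `Q`'s of the preceding stage alone
exceeded half of the present `2^r`. -/
theorem two_pow_stage_le (n : ℕ) : (A.st n).stage = firstStage K d ∨
    (2 : ℝ) ^ (A.st n).stage ≤ 2 * ∑ t ∈ Finset.range n, A.Q t := by
  have key : ∀ n, (A.st n).total ≤ ∑ t ∈ Finset.range n, A.Q t := by
    intro n
    induction n with
    | zero => rw [A.st_zero]; simp [AgentState.fresh]
    | succ n ih =>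
      rw [Finset.sum_range_succ]
      by_cases h : A.Cont n
      · rw [A.st_succ_of_cont h]; simp only; linarith
      · rw [A.st_succ_of_not_cont h]
        exact add_nonneg (Finset.sum_nonneg fun t _ => A.Q_nonneg hδ hK t) (A.Q_nonneg hδ hK n)
  induction n with
  | zero => left; rw [A.st_zero]; rfl
  | succ n ih =>
    rw [Finset.sum_range_succ]
    have hQ := A.Q_nonneg hδ hK n
    by_cases h : A.Cont n
    · rw [A.st_succ_of_cont h]
      rcases ih with ih | ih
      · left; exact ih
      · right; simp only; linarith
    · right
      rw [A.st_succ_of_not_cont h]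
      simp only [AgentState.fresh]
      rw [pow_succ]
      have := key n
      have := not_le.1 h
      linarith

theorem sum_Q_le (n : ℕ) : ∑ t ∈ Finset.range n, A.Q t ≤
    ∑ s ∈ Finset.range n, ((d : ℝ) + Real.exp 1 / 2 * ∑ i, A.p s i / A.q s i) := by
  refine le_trans (le_of_eq ?_) (A.sum_shift_le
    (g := fun s => (d : ℝ) + Real.exp 1 / 2 * ∑ i, A.p s i / A.q s i) (fun s => ?_) n)
  · exact Finset.sum_congr rfl fun t _ => by rw [A.Q_eq, qTerm]; rfl
  · have : 0 ≤ ∑ i, A.p s i / A.q s i :=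
      Finset.sum_nonneg fun i _ => (div_pos (A.p_pos hδ hK _ i) (A.q_pos hδ hK _ i)).le
    positivity

/-- Since `Q ≤ K e (d + 1) ≤ 2^(r₀)`, the stage satisfies `2^(r - r₀) ≤ 2n`. The factor `2` before
the logarithm comes from `ln 2 > 1/2`. -/
theorem stage_sub_le {n : ℕ} (hn : 1 ≤ n) :
    ((A.st n).stage : ℝ) - firstStage K d ≤ 1 + 2 * Real.log n := by
  have hn' : (1 : ℝ) ≤ n := by exact_mod_cast hn
  have hlog := Real.log_nonneg hn'
  rcases A.two_pow_stage_le hδ hK n with h | h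
  · rw [h, sub_self]; linarith
  have hle := A.firstStage_le n
  have h1 : ∑ t ∈ Finset.range n, A.Q t ≤ n * scale K d := by
    refine (A.sum_Q_le hδ hK n).trans ?_
    calc _ ≤ ∑ _s ∈ Finset.range n, scale K d := by
          refine Finset.sum_le_sum fun s _ => ?_
          have : ∑ i, A.p s i / A.q s i ≤ K := by
            calc _ ≤ ∑ _i : Fin K, (1 : ℝ) :=
                  Finset.sum_le_sum fun i _ => A.p_div_q_le_one hδ hK s i
              _ = _ := by simp
          have he := Real.add_one_le_exp (1 : ℝ)
          have hK' : (2 : ℝ) ≤ K := by exact_mod_cast hK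
          have hd : (0 : ℝ) ≤ d := Nat.cast_nonneg d
          have h3 : 1 ≤ (K : ℝ) * Real.exp 1 := by nlinarith
          unfold scale
          nlinarith [mul_le_mul_of_nonneg_right h3 hd]
      _ = _ := by simp
  have h2 : scale K d ≤ 2 ^ firstStage K d := by
    refine le_trans ?_ (two_pow_firstStage hK d).1
    have := one_le_log_mul_scale hK d
    have := scale_pos hK d
    nlinarith
  have h3 : (2 : ℝ) ^ ((A.st n).stage - firstStage K d) ≤ 2 * n := by
    have h4 : (2 : ℝ) ^ (A.st n).stage
        = 2 ^ ((A.st n).stage - firstStage K d) * 2 ^ firstStage K d := by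
      rw [← pow_add, Nat.sub_add_cancel hle]
    have h5 : (0 : ℝ) < 2 ^ firstStage K d := by positivity
    have h6 : n * scale K d ≤ n * (2 : ℝ) ^ firstStage K d := by gcongr
    refine le_of_mul_le_mul_right ?_ h5
    rw [← h4]
    linarith
  have h4 := Real.log_le_log (by positivity) h3
  rw [Real.log_pow, Real.log_mul two_ne_zero (by positivity), Nat.cast_sub hle] at h4
  have h5 := Real.log_two_gt_d9
  by_contra! hcon
  nlinarith

end Pos

end AgentPath

/-! ### Expected regret of one agent. -/

section Agent

variable {V : Type*} [Fintype V] {K T : ℕ} {G : SimpleGraph V} {d ttl : V → ℕ} {δ : ℝ}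
  {ℓ : ℕ → Fin K → ℝ}

theorem playProb_le_qProb (hδ : 0 < δ) (hK : 0 < K) (a : Fin T → V → Fin K) (t : ℕ) (v : V)
    (i : Fin K) : playProb G d ttl δ ℓ a t v i ≤ qProb G d ttl δ ℓ a t v i := by
  classical
  unfold qProb hitProb
  rw [← Finset.mul_prod_erase _ _ (mem_inNbhd_self G d ttl v), le_sub_comm]
  refine mul_le_of_le_one_right (sub_nonneg.2 (actionProb_le_one hδ hK _ i)) ?_
  exact Finset.prod_le_one (fun u _ => sub_nonneg.2 (actionProb_le_one hδ hK _ i))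
    (fun u _ => sub_le_self _ (playProb_pos hδ hK a t u i).le)

theorem qProb_pos (hδ : 0 < δ) (hK : 0 < K) (a : Fin T → V → Fin K) (t : ℕ) (v : V)
    (i : Fin K) : 0 < qProb G d ttl δ ℓ a t v i :=
  (playProb_pos hδ hK a t v i).trans_le (playProb_le_qProb hδ hK a t v i)

/-- The evolution of agent `v` when the actions `a` are played. -/
def agentPath (hδ : 0 < δ) (hK : 0 < K) (hℓ : ∀ t i, 0 ≤ ℓ t i ∧ ℓ t i ≤ 1)
    (G : SimpleGraph V) (d ttl : V → ℕ) (a : Fin T → V → Fin K) (v : V) : AgentPath K δ (d v) where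
  st t := run G d ttl δ ℓ a t v
  est t := estAt G d ttl δ ℓ a t v
  q s := qProb G d ttl δ ℓ a s v
  Q t := qAt G d ttl δ ℓ a t v
  st_zero := run_zero G d ttl δ ℓ a v
  st_succ t := run_succ G d ttl δ ℓ a t v
  Q_eq _ := rfl
  est_eq_zero _ h _ := if_neg (not_lt.2 h)
  est_nonneg t i := by
    have hq := qProb_pos (G := G) (d := d) (ttl := ttl) (ℓ := ℓ) hδ hK a (t - d v) v i
    have h0 := (hℓ (t - d v) i).1
    unfold estAt lossEst
    split_ifs <;> first | exact le_rfl | positivity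
  est_le t i := by
    have hq := qProb_pos (G := G) (d := d) (ttl := ttl) (ℓ := ℓ) hδ hK a (t - d v) v i
    have h1 := div_le_div_of_nonneg_right (hℓ (t - d v) i).2 hq.le
    unfold estAt lossEst
    split_ifs
    · rwa [mul_one]
    · rw [mul_zero]; positivity
    · positivity
  prob_le t i := playProb_le_qProb hδ hK a t v i

/-- The arbitrary `F` will carry the indicator of not restarting, the learning rate and the
probability `p_t(i, v)`. -/
theorem dependsOn_state (F : AgentState K → ℝ → ℝ) (t : ℕ) (v : V) :
    DependsOn (fun a : Fin T → V → Fin K =>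
      F (run G d ttl δ ℓ a t v) (qAt G d ttl δ ℓ a t v)) {τ : Fin T | (τ : ℕ) < t - d v} :=
  fun a a' h => by
    have h1 := dependsOn_run_sub G d ttl δ ℓ t v h
    have h2 := dependsOn_qAt G d ttl δ ℓ t v h
    simp only at h1 h2 ⊢
    rw [h1, h2]

/-- The loss estimates are conditionally unbiased. -/
theorem expect_mul_estAt (hδ : 0 < δ) (hK : 0 < K) (F : AgentState K → ℝ → ℝ) {t : ℕ} (ht : t < T)
    (v : V) (i : Fin K) :
    expect G d ttl δ ℓ (fun a : Fin T → V → Fin K =>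
      F (run G d ttl δ ℓ a t v) (qAt G d ttl δ ℓ a t v) * estAt G d ttl δ ℓ a t v i) =
    expect G d ttl δ ℓ (fun a : Fin T → V → Fin K =>
      F (run G d ttl δ ℓ a t v) (qAt G d ttl δ ℓ a t v) *
        if d v < (run G d ttl δ ℓ a t v).clock then ℓ (t - d v) i else 0) := by
  classical
  have hs : t - d v < T := by omega
  have h := expect_hit (G := G) (d := d) (ttl := ttl) (δ := δ) (ℓ := ℓ) hδ hK hs v i
    -- The importance weight `1 / q` is determined before the round of the hit, so it belongs to the
    -- predictable factor; it cancels against the probability of the hit.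
    (X := fun a => (F (run G d ttl δ ℓ a t v) (qAt G d ttl δ ℓ a t v) *
        if d v < (run G d ttl δ ℓ a t v).clock then ℓ (t - d v) i else 0) /
          qProb G d ttl δ ℓ a (t - d v) v i) (fun a a' h => by
      have h1 := dependsOn_state (G := G) (d := d) (ttl := ttl) (δ := δ) (ℓ := ℓ)
        (fun s q => F s q * if d v < s.clock then ℓ (t - d v) i else 0) t v h
      have h2 := dependsOn_qProb G d ttl δ ℓ (t - d v) v h
      simp only at h1 h2 ⊢
      rw [h1, h2])
  refine Eq.trans ?_ (h.trans ?_)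
  · congr 1
    funext a
    unfold estAt lossEst
    split_ifs <;> ring
  · congr 1
    funext a
    exact div_mul_cancel₀ _ (qProb_pos hδ hK a _ v i).ne'

/-- The conditional second moment of the loss estimates. -/
theorem expect_mul_estAt_sq (hδ : 0 < δ) (hK : 0 < K) (F : AgentState K → ℝ → ℝ) {t : ℕ}
    (ht : t < T) (v : V) (i : Fin K) :
    expect G d ttl δ ℓ (fun a : Fin T → V → Fin K =>
      F (run G d ttl δ ℓ a t v) (qAt G d ttl δ ℓ a t v) * estAt G d ttl δ ℓ a t v i ^ 2) =
    expect G d ttl δ ℓ (fun a : Fin T → V → Fin K =>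
      F (run G d ttl δ ℓ a t v) (qAt G d ttl δ ℓ a t v) *
        if d v < (run G d ttl δ ℓ a t v).clock then
          ℓ (t - d v) i ^ 2 / qProb G d ttl δ ℓ a (t - d v) v i else 0) := by
  classical
  have hs : t - d v < T := by omega
  have h := expect_hit (G := G) (d := d) (ttl := ttl) (δ := δ) (ℓ := ℓ) hδ hK hs v i
    (X := fun a => (F (run G d ttl δ ℓ a t v) (qAt G d ttl δ ℓ a t v) *
        if d v < (run G d ttl δ ℓ a t v).clock then ℓ (t - d v) i ^ 2 else 0) /
          qProb G d ttl δ ℓ a (t - d v) v i ^ 2) (fun a a' h => by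
      have h1 := dependsOn_state (G := G) (d := d) (ttl := ttl) (δ := δ) (ℓ := ℓ)
        (fun s q => F s q * if d v < s.clock then ℓ (t - d v) i ^ 2 else 0) t v h
      have h2 := dependsOn_qProb G d ttl δ ℓ (t - d v) v h
      simp only at h1 h2 ⊢
      rw [h1, h2])
  refine Eq.trans ?_ (h.trans ?_)
  · congr 1
    funext a
    unfold estAt lossEst
    split_ifs <;> ring
  · congr 1
    funext a
    have := (qProb_pos (G := G) (d := d) (ttl := ttl) (ℓ := ℓ) hδ hK a (t - d v) v i).ne'
    split_ifs
    · field_simp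
    · simp

/-- A fixed `s` lies in the window of `t` only for `s < t ≤ s + d`, which allows at most `d` values
of `t`. -/
theorem sum_range_sum_Ico_le (T d : ℕ) {D : ℕ → ℝ} (hD : ∀ t, 0 ≤ D t) :
    ∑ t ∈ Finset.range T, ∑ s ∈ Finset.Ico (t - d) t, D s ≤ d * ∑ s ∈ Finset.range T, D s := by
  calc _ = ∑ s ∈ Finset.range T, ∑ t ∈ Finset.range T with s < t ∧ t ≤ s + d, D s := by
        refine Finset.sum_comm' fun t s => ?_
        simp only [Finset.mem_range, Finset.mem_Ico, Finset.mem_filter]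
        omega
    _ ≤ ∑ s ∈ Finset.range T, d * D s := by
        refine Finset.sum_le_sum fun s _ => ?_
        rw [Finset.sum_const, nsmul_eq_mul]
        refine mul_le_mul_of_nonneg_right ?_ (hD s)
        have : (Finset.range T).filter (fun t => s < t ∧ t ≤ s + d) ⊆ Finset.Ioc s (s + d) := by
          intro t ht
          simp only [Finset.mem_filter] at ht
          simpa using ht.2
        have := Finset.card_le_card this
        rw [Nat.card_Ioc, Nat.add_sub_cancel_left] at this
        exact_mod_cast this
    _ = _ := by rw [Finset.mul_sum]

variable (hδ : 0 < δ) (hK : 2 ≤ K) (hℓ : ∀ t i, 0 ≤ ℓ t i ∧ ℓ t i ≤ 1)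
include hδ hK hℓ

open Classical in
theorem expect_cont_regret {t : ℕ} (ht : t < T) (v : V) (k : Fin K) :
    expect G d ttl δ ℓ (fun a : Fin T → V → Fin K =>
      let A := agentPath hδ (by omega) hℓ G d ttl a v
      if d v < (A.st t).clock ∧ A.Cont t then
        ∑ i, A.p t i * ℓ (t - d v) i - ℓ (t - d v) k else 0) =
    expect G d ttl δ ℓ (fun a : Fin T → V → Fin K =>
      let A := agentPath hδ (by omega) hℓ G d ttl a v
      if A.Cont t then ∑ i, A.p t i * A.est t i - A.est t k else 0) := by
  have hK0 : 0 < K := by omega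
  set F : Fin K → AgentState K → ℝ → ℝ := fun i s q =>
    if s.total + q ≤ 2 ^ s.stage then actionProb δ s.weight i else 0
  set F' : AgentState K → ℝ → ℝ := fun s q => if s.total + q ≤ 2 ^ s.stage then 1 else 0
  have h1 := fun i => expect_mul_estAt (G := G) (d := d) (ttl := ttl) (ℓ := ℓ) hδ hK0 (F i) ht v i
  have h2 := expect_mul_estAt (G := G) (d := d) (ttl := ttl) (ℓ := ℓ) hδ hK0 F' ht v k
  have h3 := congrArg₂ (· - ·) (Finset.sum_congr rfl fun i (_ : i ∈ Finset.univ) => h1 i) h2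
  simp only [← expect_sum, ← expect_sub] at h3
  refine Eq.trans ?_ (h3.symm.trans ?_)
  · congr 1
    funext a
    set A := agentPath hδ hK0 hℓ G d ttl a v
    change (if d v < (A.st t).clock ∧ A.Cont t then _ else _) =
      ∑ i, (if A.Cont t then A.p t i else 0) * (if d v < (A.st t).clock then _ else _) -
        (if A.Cont t then 1 else 0) * (if d v < (A.st t).clock then _ else _)
    by_cases hc : A.Cont t <;> by_cases hu : d v < (A.st t).clock <;> simp [hc, hu]
  · congr 1
    funext a
    set A := agentPath hδ hK0 hℓ G d ttl a v
    change ∑ i, (if A.Cont t then A.p t i else 0) * A.est t i -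
        (if A.Cont t then 1 else 0) * A.est t k =
      if A.Cont t then ∑ i, A.p t i * A.est t i - A.est t k else 0
    by_cases hc : A.Cont t <;> simp [hc]

open Classical in
-- By unbiasedness `∑ p · est` averages to `∑ p · ℓ ≤ 1` in rounds with feedback. What remains is
-- `η`, which the summand `d` of `Q` will absorb.
theorem expect_drift_le {t : ℕ} (ht : t < T) (v : V) :
    expect G d ttl δ ℓ (fun a : Fin T → V → Fin K =>
      let A := agentPath hδ (by omega) hℓ G d ttl a v
      if A.Cont t then A.eta t * ∑ i, A.p t i * A.est t i + δ else 0) ≤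
    expect G d ttl δ ℓ (fun a : Fin T → V → Fin K =>
      let A := agentPath hδ (by omega) hℓ G d ttl a v
      if d v < (A.st t).clock ∧ A.Cont t then A.eta t else 0) + δ := by
  have hK0 : 0 < K := by omega
  set F : Fin K → AgentState K → ℝ → ℝ := fun i s q =>
    if s.total + q ≤ 2 ^ s.stage then etaStage K (d v) s.stage * actionProb δ s.weight i else 0
  have h1 := fun i => expect_mul_estAt (G := G) (d := d) (ttl := ttl) (ℓ := ℓ) hδ hK0 (F i) ht v i
  have h3 := Finset.sum_congr rfl fun i (_ : i ∈ Finset.univ) => h1 i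
  simp only [← expect_sum] at h3
  have hconst := expect_const (G := G) (d := d) (ttl := ttl) (ℓ := ℓ) (T := T) hδ hK0 δ
  calc _ ≤ expect G d ttl δ ℓ (fun a : Fin T → V → Fin K => (∑ i,
        F i (run G d ttl δ ℓ a t v) (qAt G d ttl δ ℓ a t v) * estAt G d ttl δ ℓ a t v i) + δ) := by
        refine expect_mono hδ hK0 fun a => ?_
        set A := agentPath hδ hK0 hℓ G d ttl a v
        change _ ≤ (∑ i, (if A.Cont t then A.eta t * A.p t i else 0) * A.est t i) + δ
        by_cases hc : A.Cont t
        · simp only [hc, if_true]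
          rw [Finset.mul_sum]
          exact add_le_add_left (le_of_eq (Finset.sum_congr rfl fun i _ => by ring)) _
        · simp only [hc, if_false, zero_mul, Finset.sum_const_zero]
          linarith
    _ ≤ _ := by
        rw [expect_add, h3, hconst]
        refine add_le_add_left ?_ _
        refine expect_mono hδ hK0 fun a => ?_
        set A := agentPath hδ hK0 hℓ G d ttl a v
        change (∑ i, (if A.Cont t then A.eta t * A.p t i else 0) *
          (if d v < (A.st t).clock then ℓ (t - d v) i else 0)) ≤ _
        by_cases hc : A.Cont t <;> by_cases hu : d v < (A.st t).clock <;>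
          simp only [hc, hu, if_true, if_false, and_true, and_false, zero_mul,
            mul_zero, Finset.sum_const_zero, le_refl]
        calc _ ≤ ∑ i, A.eta t * A.p t i := Finset.sum_le_sum fun i _ =>
              mul_le_of_le_one_right
                (mul_nonneg (A.eta_pos hK t).le (A.p_pos hδ hK t i).le) (hℓ _ i).2
          _ = A.eta t := by rw [← Finset.mul_sum, A.sum_p hδ hK, mul_one]

open Classical in
theorem expect_variance_le (hT : δ * T ≤ 1) {t : ℕ} (ht : t < T) (v : V) :
    expect G d ttl δ ℓ (fun a : Fin T → V → Fin K =>
      let A := agentPath hδ (by omega) hℓ G d ttl a v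
      if A.Cont t then A.eta t / 2 * ∑ i, A.p t i * A.est t i ^ 2 else 0) ≤
    expect G d ttl δ ℓ (fun a : Fin T → V → Fin K =>
      let A := agentPath hδ (by omega) hℓ G d ttl a v
      if d v < (A.st t).clock ∧ A.Cont t then
        A.eta t * (Real.exp 1 / 2 * ∑ i, A.p (t - d v) i / A.q (t - d v) i) else 0) := by
  have hK0 : 0 < K := by omega
  set F : Fin K → AgentState K → ℝ → ℝ := fun i s q =>
    if s.total + q ≤ 2 ^ s.stage then etaStage K (d v) s.stage / 2 * actionProb δ s.weight i else 0
  have h1 := fun i =>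
    expect_mul_estAt_sq (G := G) (d := d) (ttl := ttl) (ℓ := ℓ) hδ hK0 (F i) ht v i
  have h3 := Finset.sum_congr rfl fun i (_ : i ∈ Finset.univ) => h1 i
  simp only [← expect_sum] at h3
  refine le_trans (le_of_eq (Eq.trans ?_ h3)) ?_
  · congr 1
    funext a
    set A := agentPath hδ hK0 hℓ G d ttl a v
    change _ = ∑ i, (if A.Cont t then A.eta t / 2 * A.p t i else 0) * A.est t i ^ 2
    by_cases hc : A.Cont t
    · simp only [hc, if_true]
      rw [Finset.mul_sum]
      exact Finset.sum_congr rfl fun i _ => by ring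
    · simp [hc]
  · refine expect_mono hδ hK0 fun a => ?_
    set A := agentPath hδ hK0 hℓ G d ttl a v
    change (∑ i, (if A.Cont t then A.eta t / 2 * A.p t i else 0) *
      (if d v < (A.st t).clock then ℓ (t - d v) i ^ 2 / A.q (t - d v) i else 0)) ≤ _
    by_cases hc : A.Cont t <;> by_cases hu : d v < (A.st t).clock <;>
      simp only [hc, hu, if_true, if_false, and_true, and_false, zero_mul,
        mul_zero, Finset.sum_const_zero, le_refl]
    rw [← mul_assoc, Finset.mul_sum]
    refine Finset.sum_le_sum fun i _ => ?_
    have hη := A.eta_pos hK t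
    have hp := A.p_pos hδ hK (t - d v) i
    have hq := A.q_pos hδ hK (t - d v) i
    -- A clock exceeding `d v` in round `t < T` forces `d v ≤ T`.
    have hdT : δ * d v ≤ 1 := by
      have : (d v : ℝ) ≤ T := by
        have := A.clock_le t
        exact_mod_cast (by omega : d v ≤ T)
      nlinarith
    have hg := A.p_le_exp_mul hδ hK hdT hu i
    have hl : ℓ (t - d v) i ^ 2 ≤ 1 := pow_le_one₀ (hℓ _ i).1 (hℓ _ i).2
    calc A.eta t / 2 * A.p t i * (ℓ (t - d v) i ^ 2 / A.q (t - d v) i)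
        ≤ A.eta t / 2 * (Real.exp 1 * A.p (t - d v) i) * (1 / A.q (t - d v) i) := by gcongr
      _ = _ := by ring

open Classical in
/-- The regret along one trajectory in terms of the loss estimates. -/
theorem regret_path_le (hT1 : 1 ≤ T) (a : Fin T → V → Fin K) (v : V) (k : Fin K) :
    let A := agentPath hδ (by omega) hℓ G d ttl a v
    ∑ s ∈ Finset.range T, (∑ i, A.p s i * ℓ s i - ℓ s k) ≤
      ∑ t ∈ Finset.range T, (if d v < (A.st t).clock ∧ A.Cont t then
        ∑ i, A.p t i * ℓ (t - d v) i - ℓ (t - d v) k else 0) +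
      d v * ∑ t ∈ Finset.range T,
        (if A.Cont t then A.eta t * ∑ i, A.p t i * A.est t i + δ else 0) +
      (d v + 1) * (2 + 2 * Real.log T) := by
  intro A
  set x : ℕ → ℝ := fun s => ∑ i, A.p s i * ℓ s i - ℓ s k with hx
  set D : ℕ → ℝ := fun t => if A.Cont t then A.eta t * ∑ i, A.p t i * A.est t i + δ else 0 with hD
  have hη := fun t => A.eta_pos hK t
  have hp := A.p_pos hδ hK
  have hD0 : ∀ t, 0 ≤ D t := fun t => by
    simp only [hD]
    split_ifs
    · have : 0 ≤ ∑ i, A.p t i * A.est t i :=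
        Finset.sum_nonneg fun i _ => mul_nonneg (hp t i).le (A.est_nonneg t i)
      have := mul_nonneg (hη t).le this
      linarith
    · exact le_rfl
  have hx1 : ∀ s, x s ≤ 1 := fun s => by
    have : ∑ i, A.p s i * ℓ s i ≤ ∑ i, A.p s i :=
      Finset.sum_le_sum fun i _ => mul_le_of_le_one_right (hp s i).le (hℓ s i).2
    rw [A.sum_p hδ hK] at this
    have := (hℓ s k).1
    simp only [hx]
    linarith
  -- The shift bound needs nonnegative terms, while `x` may be negative; hence it is applied to `1 -
  -- x`. Rearranging charges `1` to every round `t` without a usable update.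
  have hcover := A.sum_shift_le (g := fun s => 1 - x s) (fun s => sub_nonneg.2 (hx1 s)) T
  have hcount := (A.card_uncovered_le T).trans (mul_le_mul_of_nonneg_left
    (add_le_add_left (A.stage_sub_le hδ hK hT1) 1) (by positivity))
  have h1 : ∑ t ∈ Finset.range T, x t ≤
      ∑ t ∈ Finset.range T, (if d v < (A.st t).clock ∧ A.Cont t then x (t - d v) else 0) +
      ∑ t ∈ Finset.range T, (if d v < (A.st t).clock ∧ A.Cont t then (0 : ℝ) else 1) := by
    have h2 : ∑ t ∈ Finset.range T, (1 - (if d v < (A.st t).clock ∧ A.Cont t then (0 : ℝ) else 1)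
        - (if d v < (A.st t).clock ∧ A.Cont t then x (t - d v) else 0)) ≤
        ∑ t ∈ Finset.range T, (1 - x t) := by
      refine le_trans (Finset.sum_le_sum fun t _ => ?_) hcover
      have := hx1 (t - d v)
      by_cases hu : d v < (A.st t).clock <;> by_cases hc : A.Cont t <;> simp [hu, hc, this]
    simp only [Finset.sum_sub_distrib] at h2
    linarith
  have h2 : ∀ t, (if d v < (A.st t).clock ∧ A.Cont t then x (t - d v) else 0) ≤
      (if d v < (A.st t).clock ∧ A.Cont t then
        ∑ i, A.p t i * ℓ (t - d v) i - ℓ (t - d v) k else 0) +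
      ∑ s ∈ Finset.Ico (t - d v) t, D s := by
    intro t
    split_ifs with hu
    · have hdt : d v ≤ t := Nat.lt_succ_iff.1 (hu.1.trans_le (A.clock_le t))
      have hts : t - d v + d v = t := Nat.sub_add_cancel hdt
      have hc := (A.cont_of_lt_clock (t - d v) (d v) (by rw [hts]; exact hu.1)).1
      have h3 := A.p_sub_p_add_le hδ hK (t - d v) (d v) hc
      rw [hts] at h3
      -- The loss suffered in round `t - d v` was weighted by `p_(t-d)`, but exponential weights
      -- control `p_t`. The difference is the accumulated decrease of the probabilities, and no
      -- restart occurs in this window.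
      have h4 : ∑ i, A.p (t - d v) i * ℓ (t - d v) i - ∑ i, A.p t i * ℓ (t - d v) i ≤
          ∑ s ∈ Finset.Ico (t - d v) t, D s := by
        rw [← Finset.sum_sub_distrib]
        calc _ ≤ ∑ i, ∑ s ∈ Finset.Ico (t - d v) t,
              (if A.Cont s then A.p s i * (A.eta s * A.est s i + δ) else 0) := by
              refine Finset.sum_le_sum fun i _ => ?_
              rw [← sub_mul]
              refine (mul_le_mul_of_nonneg_right (h3 i) (hℓ _ i).1).trans
                (mul_le_of_le_one_right (Finset.sum_nonneg fun s _ => ?_) (hℓ _ i).2)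
              split_ifs
              · have := mul_nonneg (hη s).le (A.est_nonneg s i)
                exact mul_nonneg (hp s i).le (by linarith)
              · exact le_rfl
          _ = _ := by
              rw [Finset.sum_comm]
              refine Finset.sum_congr rfl fun s _ => ?_
              simp only [hD]
              split_ifs
              · simp only [mul_add, Finset.sum_add_distrib]
                rw [← Finset.sum_mul, A.sum_p hδ hK, one_mul, Finset.mul_sum]
                congr 1
                exact Finset.sum_congr rfl fun i _ => by ring
              · simp
      simp only [hx]
      linarith
    · rw [zero_add]
      exact Finset.sum_nonneg fun s _ => hD0 s
  have h3 := Finset.sum_le_sum fun t (_ : t ∈ Finset.range T) => h2 t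
  rw [Finset.sum_add_distrib] at h3
  have h4 := sum_range_sum_Ico_le T (d v) hD0
  linarith

open Classical in
/-- The regret of one agent. -/
theorem expect_regret_agent_le (hT : δ * T ≤ 1) (hδ1 : δ ≤ 1) (hT1 : 1 ≤ T) (v : V) (k : Fin K) :
    expect G d ttl δ ℓ (fun a : Fin T → V → Fin K => ∑ t : Fin T, ℓ t (a t v)) -
        ∑ t : Fin T, ℓ t k ≤
      10 * expect G d ttl δ ℓ (fun a : Fin T → V → Fin K =>
        stageScale K (run G d ttl δ ℓ a T v).stage) + d v + (d v + 1) * (2 + 2 * Real.log T) := by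
  have hK0 : 0 < K := by omega
  set E : ((Fin T → V → Fin K) → ℝ) → ℝ := expect G d ttl δ ℓ with hE
  set A : (Fin T → V → Fin K) → AgentPath K δ (d v) := fun a => agentPath hδ hK0 hℓ G d ttl a v
  have hEmono : ∀ {f g : (Fin T → V → Fin K) → ℝ}, (∀ a, f a ≤ g a) → E f ≤ E g :=
    fun h => expect_mono hδ hK0 h
  have hEadd : ∀ f g, E (fun a => f a + g a) = E f + E g := expect_add
  have hEmul : ∀ c f, E (fun a => c * f a) = c * E f := expect_const_mul
  have hEsum : ∀ f : ℕ → (Fin T → V → Fin K) → ℝ, E (fun a => ∑ t ∈ Finset.range T, f t a) =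
      ∑ t ∈ Finset.range T, E (f t) := fun f => expect_sum _ f
  have hEconst : ∀ c, E (fun _ => c) = c := expect_const hδ hK0
  have h0 : E (fun a => ∑ t : Fin T, ℓ t (a t v)) - ∑ t : Fin T, ℓ t k =
      E (fun a => ∑ s ∈ Finset.range T, (∑ i, (A a).p s i * ℓ s i - ℓ s k)) := by
    simp only [Finset.sum_range]
    rw [hE, expect_sum, expect_sum, ← Finset.sum_sub_distrib]
    refine Finset.sum_congr rfl fun t _ => ?_
    rw [expect_play hδ hK0 t v (ℓ t), expect_sub, expect_const hδ hK0]
    rfl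
  have h1 : E (fun a => ∑ s ∈ Finset.range T, (∑ i, (A a).p s i * ℓ s i - ℓ s k)) ≤
      ∑ t ∈ Finset.range T, E (fun a => if d v < ((A a).st t).clock ∧ (A a).Cont t then
        ∑ i, (A a).p t i * ℓ (t - d v) i - ℓ (t - d v) k else 0) +
      d v * ∑ t ∈ Finset.range T, E (fun a => if (A a).Cont t then
        (A a).eta t * ∑ i, (A a).p t i * (A a).est t i + δ else 0) +
      (d v + 1) * (2 + 2 * Real.log T) := by
    have h := hEmono fun a => regret_path_le (G := G) (d := d) (ttl := ttl) hδ hK hℓ hT1 a v k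
    simp only [hEadd, hEmul, hEsum, hEconst] at h
    rw [hEsum]
    exact h
  have h2 : ∑ t ∈ Finset.range T, E (fun a => if d v < ((A a).st t).clock ∧ (A a).Cont t then
        ∑ i, (A a).p t i * ℓ (t - d v) i - ℓ (t - d v) k else 0) ≤
      6 * E (fun a => stageScale K ((A a).st T).stage) + ∑ t ∈ Finset.range T,
        E (fun a => if d v < ((A a).st t).clock ∧ (A a).Cont t then (A a).eta t *
          (Real.exp 1 / 2 * ∑ i, (A a).p (t - d v) i / (A a).q (t - d v) i) else 0) := by
    rw [Finset.sum_congr rfl fun t ht =>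
      expect_cont_regret (G := G) (d := d) (ttl := ttl) hδ hK hℓ (Finset.mem_range.1 ht) v k]
    have h3 := hEmono fun a => (A a).sum_cont_le hδ hK hδ1 T hT k
    simp only [hEadd, hEmul, hEsum] at h3
    refine h3.trans (add_le_add_right (Finset.sum_le_sum fun t ht => ?_) _)
    exact expect_variance_le (G := G) (d := d) (ttl := ttl) hδ hK hℓ hT (Finset.mem_range.1 ht) v
  have h3 : d v * ∑ t ∈ Finset.range T, E (fun a => if (A a).Cont t then
        (A a).eta t * ∑ i, (A a).p t i * (A a).est t i + δ else 0) ≤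
      d v * ∑ t ∈ Finset.range T,
        E (fun a => if d v < ((A a).st t).clock ∧ (A a).Cont t then (A a).eta t else 0) + d v := by
    have h4 : ∑ t ∈ Finset.range T, E (fun a => if (A a).Cont t then
        (A a).eta t * ∑ i, (A a).p t i * (A a).est t i + δ else 0) ≤ ∑ t ∈ Finset.range T,
        E (fun a => if d v < ((A a).st t).clock ∧ (A a).Cont t then (A a).eta t else 0) + 1 := by
      refine (Finset.sum_le_sum fun t ht => expect_drift_le (G := G) (d := d) (ttl := ttl) hδ hK hℓ
        (Finset.mem_range.1 ht) v).trans ?_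
      rw [Finset.sum_add_distrib, Finset.sum_const, Finset.card_range, nsmul_eq_mul]
      exact add_le_add_right (by linarith) _
    have := mul_le_mul_of_nonneg_left h4 (Nat.cast_nonneg (α := ℝ) (d v))
    linarith
  -- The second-moment and drift terms recombine pointwise into `η · Q`. This contributes `4`
  -- scales, in addition to the `6` from the potential.
  have h4 : ∑ t ∈ Finset.range T,
        E (fun a => if d v < ((A a).st t).clock ∧ (A a).Cont t then (A a).eta t *
          (Real.exp 1 / 2 * ∑ i, (A a).p (t - d v) i / (A a).q (t - d v) i) else 0) +
      d v * ∑ t ∈ Finset.range T,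
        E (fun a => if d v < ((A a).st t).clock ∧ (A a).Cont t then (A a).eta t else 0) ≤
      4 * E (fun a => stageScale K ((A a).st T).stage) := by
    rw [← hEmul, ← hEsum, ← hEsum, ← hEmul, ← hEadd]
    refine hEmono fun a => le_trans (le_of_eq ?_) ((A a).sum_eta_mul_Q_le hδ hK T)
    rw [Finset.mul_sum, ← Finset.sum_add_distrib]
    refine Finset.sum_congr rfl fun t _ => ?_
    by_cases hc : (A a).Cont t <;> by_cases hu : d v < ((A a).st t).clock <;>
      simp only [hc, hu, if_true, if_false, and_true, and_false, mul_zero,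
        add_zero, (A a).Q_eq, qTerm]
    unfold AgentPath.p
    ring
  rw [h0]
  have h5 : E (fun a => stageScale K ((A a).st T).stage) = E (fun a : Fin T → V → Fin K =>
        stageScale K (run G d ttl δ ℓ a T v).stage) := rfl
  rw [← h5]
  linarith

/-- The doubling-trick parameter of the last stage of one agent. -/
theorem two_pow_stage_agent_le (a : Fin T → V → Fin K) (v : V) :
    (2 : ℝ) ^ (run G d ttl δ ℓ a T v).stage ≤ 2 ^ firstStage K (d v) +
      ∑ s ∈ Finset.range T, (2 * (d v : ℝ) + Real.exp 1 *
        ∑ i, playProb G d ttl δ ℓ a s v i / qProb G d ttl δ ℓ a s v i) := by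
  have hK0 : 0 < K := by omega
  set A := agentPath hδ hK0 hℓ G d ttl a v
  have h1 := A.sum_Q_le hδ hK T
  have h2 : 2 * ∑ s ∈ Finset.range T, ((d v : ℝ) + Real.exp 1 / 2 * ∑ i, A.p s i / A.q s i) =
      ∑ s ∈ Finset.range T, (2 * (d v : ℝ) + Real.exp 1 *
        ∑ i, playProb G d ttl δ ℓ a s v i / qProb G d ttl δ ℓ a s v i) := by
    rw [Finset.mul_sum]
    refine Finset.sum_congr rfl fun s _ => ?_
    change 2 * ((d v : ℝ) + Real.exp 1 / 2 * ∑ i, A.p s i / A.q s i) =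
      2 * (d v : ℝ) + Real.exp 1 * ∑ i, A.p s i / A.q s i
    ring
  rw [← h2]
  have h3 : 0 ≤ ∑ s ∈ Finset.range T, A.Q s := Finset.sum_nonneg fun s _ => A.Q_nonneg hδ hK s
  rcases A.two_pow_stage_le hδ hK T with h | h
  · change (2 : ℝ) ^ (A.st T).stage ≤ _
    rw [h]
    linarith
  · have : (0 : ℝ) < 2 ^ firstStage K (d v) := by positivity
    change (2 : ℝ) ^ (A.st T).stage ≤ _
    linarith

end Agent

/-! ### Averaging over the agents. -/

section Welfare

variable {V : Type*} [Fintype V] [Nonempty V] {K T : ℕ} {G : SimpleGraph V} {d ttl : V → ℕ}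
  {ℓ : ℕ → Fin K → ℝ}

theorem half_le_log_horizon (V : Type*) [Fintype V] [Nonempty V] (hK : 2 ≤ K) (hT : 1 ≤ T) :
    1 / 2 ≤ Real.log ((T : ℝ) * Fintype.card V * K) := by
  have h : 2 ≤ T * Fintype.card V * K := by
    have : 1 ≤ Fintype.card V := Fintype.card_pos
    nlinarith [Nat.mul_le_mul hT this]
  exact_mod_cast half_le_log h

/-- The doubling-trick parameters of the last stages, summed over the agents. -/
theorem sum_two_pow_stage_le (hK : 2 ≤ K) (hT : 1 ≤ T) (hℓ : ∀ t i, 0 ≤ ℓ t i ∧ ℓ t i ≤ 1)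
    (a : Fin T → V → Fin K) :
    ∑ v, (2 : ℝ) ^ (run G d ttl (1 / T) ℓ a T v).stage ≤ ∑ v, (2 : ℝ) ^ firstStage K (d v) +
      T * (2 * ∑ v, (d v : ℝ) + Real.exp 1 * (2 * Fintype.card V +
        20 * (K * alphaP G d ttl * Real.log ((T : ℝ) * Fintype.card V * K)))) := by
  have hT0 : (0 : ℝ) < T := by exact_mod_cast hT
  have hK0 : (0 : ℝ) < K := by exact_mod_cast (by omega : 0 < K)
  have hN0 : (0 : ℝ) < Fintype.card V := by exact_mod_cast Fintype.card_pos
  have hδ : (0 : ℝ) < 1 / T := by positivity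
  have hδ1 : 1 / (T : ℝ) ≤ 1 := by rw [div_le_one hT0]; exact_mod_cast hT
  have hL := half_le_log_horizon V hK hT
  set L := Real.log ((T : ℝ) * Fintype.card V * K)
  set α : ℝ := (alphaP G d ttl : ℝ)
  have hα : 0 ≤ α := Nat.cast_nonneg _
  set p := playProb G d ttl (1 / (T : ℝ)) ℓ a
  set q := qProb G d ttl (1 / (T : ℝ)) ℓ a
  -- With the floor `β = 1 / (2TK)`, the left side is `1 + ln 2 + L`, and `1 + ln 2 < 2 ≤ 4L`.
  have hlog : 1 + Real.log (Fintype.card V / (1 / (T : ℝ) / (2 * K))) ≤ 5 * L := by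
    have : (Fintype.card V : ℝ) / (1 / (T : ℝ) / (2 * K)) = 2 * (T * Fintype.card V * K) := by
      field_simp
    rw [this, Real.log_mul two_ne_zero (by positivity)]
    linarith [Real.log_two_lt_d9]
  have hround : ∀ s, ∑ v, ∑ i, p s v i / q s v i ≤ 2 * Fintype.card V + 20 * (K * α * L) := by
    intro s
    rw [Finset.sum_comm]
    calc _ ≤ ∑ i, (2 * ∑ v, p s v i + 20 * (α * L)) := by
          refine Finset.sum_le_sum fun i _ => ?_
          have h := sum_div_hitProb_le G d ttl (p s) i (β := 1 / (T : ℝ) / (2 * K)) (by positivity)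
            (fun v => le_actionProb hδ hδ1 (by omega) (fun j =>
              ((agentPath hδ (by omega) hℓ G d ttl a v).weight_pos hδ hK s j).le) i)
            (fun v => actionProb_le_one hδ (by omega) _ i)
          have h2 := mul_le_mul_of_nonneg_left hlog (by positivity : 0 ≤ 4 * α)
          refine h.trans (add_le_add_right (h2.trans (le_of_eq (by ring))) _)
      _ = _ := by
          rw [Finset.sum_add_distrib, ← Finset.mul_sum, Finset.sum_comm]
          have : ∀ v, ∑ i, p s v i = 1 := fun v => sum_playProb hδ (by omega) a s v
          simp only [this, Finset.sum_const, Finset.card_univ, Fintype.card_fin, nsmul_eq_mul]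
          ring
  calc _ ≤ ∑ v, ((2 : ℝ) ^ firstStage K (d v) +
        ∑ s ∈ Finset.range T, (2 * (d v : ℝ) + Real.exp 1 * ∑ i, p s v i / q s v i)) :=
        Finset.sum_le_sum fun v _ => two_pow_stage_agent_le hδ hK hℓ a v
    _ = ∑ v, (2 : ℝ) ^ firstStage K (d v) + ∑ s ∈ Finset.range T, (2 * ∑ v, (d v : ℝ) +
          Real.exp 1 * ∑ v, ∑ i, p s v i / q s v i) := by
        rw [Finset.sum_add_distrib, Finset.sum_comm]
        simp only [Finset.sum_add_distrib, Finset.mul_sum]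
    _ ≤ _ := by
        refine add_le_add_right ?_ _
        refine (Finset.sum_le_card_nsmul _ _ _ fun s _ => add_le_add_right
          (mul_le_mul_of_nonneg_left (hround s) (Real.exp_pos 1).le) _).trans (le_of_eq ?_)
        rw [Finset.card_range, nsmul_eq_mul]

/-- Cost of the initial stages, polynomial and independent of `T`: `ln K · 2^(r₀) ≤ 2 (ln K)² (K e
(d + 1))²`. This is the source of the exponent `6`. -/
theorem log_mul_two_pow_firstStage_le (hK : 2 ≤ K) (n : ℕ) {S : ℝ} (hKS : (K : ℝ) ≤ S)
    (hnS : (n : ℝ) + 1 ≤ S) : Real.log K * 2 ^ firstStage K n ≤ 18 * S ^ 6 := by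
  have h1 := half_le_log hK
  have hK0 : (0 : ℝ) < K := by exact_mod_cast (by omega : 0 < K)
  have h2 : Real.log K ≤ K := (Real.log_le_sub_one_of_pos hK0).trans (by linarith)
  have h3 : Real.exp 1 ≤ 3 := Real.exp_one_lt_d9.le.trans (by norm_num)
  have hS : 0 ≤ S := hK0.le.trans hKS
  have h4 : scale K n ≤ S * 3 * S := by
    unfold scale
    have := Real.exp_pos 1
    gcongr
  have h5 := (two_pow_firstStage hK n).2
  have h6 := scale_pos hK n
  calc Real.log K * 2 ^ firstStage K n ≤ S * (2 * (S * (S * 3 * S) ^ 2)) := by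
        refine mul_le_mul (h2.trans hKS) (h5.trans ?_) (by positivity) (by linarith)
        have := h2.trans hKS
        gcongr
    _ = 18 * S ^ 6 := by ring

/-- The average regret for a target value `B` of the square-root term. -/
theorem welfareRegret_le (hK : 2 ≤ K) (hT : 1 ≤ T) (hℓ : ∀ t i, 0 ≤ ℓ t i ∧ ℓ t i ≤ 1) {B S : ℝ}
    (hB0 : 1 / 2 ≤ B) (hB : B ^ 2 = Real.log K * (meanDelay d + 1 +
      (K : ℝ) / Fintype.card V * alphaP G d ttl * Real.log ((T : ℝ) * Fintype.card V * K)) * T)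
    (hKS : (K : ℝ) ≤ S) (hdS : ∀ v, (d v : ℝ) + 1 ≤ S) :
    welfareRegret G d ttl (1 / (T : ℝ)) ℓ T ≤ 180 * S ^ 6 + 305 * B + meanDelay d +
      (meanDelay d + 1) * (2 + 2 * Real.log T) := by
  have hT0 : (0 : ℝ) < T := by exact_mod_cast hT
  have hK0 : (0 : ℝ) < K := by exact_mod_cast (by omega : 0 < K)
  have hN0 : (0 : ℝ) < Fintype.card V := by exact_mod_cast Fintype.card_pos
  have hδ : (0 : ℝ) < 1 / T := by positivity
  have hδ1 : 1 / (T : ℝ) ≤ 1 := by rw [div_le_one hT0]; exact_mod_cast hT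
  have hδT : 1 / (T : ℝ) * T ≤ 1 := by rw [one_div_mul_cancel hT0.ne']
  have hL := half_le_log_horizon V hK hT
  have hlK := half_le_log hK
  set n : ℝ := (Fintype.card V : ℝ) with hn
  set L := Real.log ((T : ℝ) * n * K)
  set α : ℝ := (alphaP G d ttl : ℝ)
  have hα : 0 ≤ α := Nat.cast_nonneg _
  set E : ((Fin T → V → Fin K) → ℝ) → ℝ := expect G d ttl (1 / (T : ℝ)) ℓ with hE
  set σ : (Fin T → V → Fin K) → V → ℕ := fun a v => (run G d ttl (1 / (T : ℝ)) ℓ a T v).stage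
  have hmean : n * meanDelay d = ∑ v, (d v : ℝ) := by
    unfold meanDelay
    rw [← mul_assoc, mul_one_div_cancel hN0.ne', one_mul]
  have hB' : 0 < B := by linarith
  have hS : 0 ≤ S := hK0.le.trans hKS
  have hpath : ∀ a, ∑ v, stageScale K (σ a v) ≤ n * (18 * S ^ 6 + 30.5 * B) := by
    intro a
    -- Tangent-line form of the square root at the target `B`. It reduces the average of square
    -- roots to a sum of `2^r` over the agents, so no concavity argument for the expectation is
    -- needed.
    have h1 : ∀ v, stageScale K (σ a v) ≤ (Real.log K * 2 ^ σ a v / B + B) / 2 := by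
      intro v
      have := stageScale_sq hK (σ a v)
      rw [← this, le_div_iff₀ two_pos, ← sub_nonneg]
      have : stageScale K (σ a v) ^ 2 / B + B - stageScale K (σ a v) * 2
          = (stageScale K (σ a v) - B) ^ 2 / B := by field_simp; ring
      rw [this]
      positivity
    have h2 := sum_two_pow_stage_le (G := G) (d := d) (ttl := ttl) hK hT hℓ a
    have h3 : Real.log K * ∑ v, (2 : ℝ) ^ firstStage K (d v) ≤ n * (18 * S ^ 6) := by
      rw [Finset.mul_sum]
      refine (Finset.sum_le_card_nsmul _ _ _ fun v _ =>
        log_mul_two_pow_firstStage_le hK (d v) hKS (hdS v)).trans (le_of_eq ?_)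
      rw [nsmul_eq_mul, Finset.card_univ]
    have h4 : Real.log K * (T * (2 * ∑ v, (d v : ℝ) + Real.exp 1 * (2 * n +
        20 * (K * α * L)))) ≤ n * (60 * B ^ 2) := by
      have h3 : Real.exp 1 ≤ 3 := Real.exp_one_lt_d9.le.trans (by norm_num)
      have hd : 0 ≤ ∑ v, (d v : ℝ) := Finset.sum_nonneg fun v _ => Nat.cast_nonneg _
      have hKα : 0 ≤ K * α * L := mul_nonneg (mul_nonneg hK0.le hα) (by linarith)
      have e : n * (60 * B ^ 2) =
          Real.log K * (T * (60 * (∑ v, (d v : ℝ) + n + K * α * L))) := by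
        rw [hB, ← hmean]
        field_simp
      rw [e]
      have : Real.exp 1 * (2 * n + 20 * (K * α * L)) ≤ 3 * (2 * n + 20 * (K * α * L)) :=
        mul_le_mul_of_nonneg_right h3 (by positivity)
      refine mul_le_mul_of_nonneg_left (mul_le_mul_of_nonneg_left ?_ hT0.le) (by linarith)
      linarith
    have h5 : Real.log K * ∑ v, (2 : ℝ) ^ σ a v ≤ n * (18 * S ^ 6 + 60 * B ^ 2) := by
      have := mul_le_mul_of_nonneg_left h2 (by linarith : 0 ≤ Real.log K)
      linarith
    calc ∑ v, stageScale K (σ a v) ≤ ∑ v, (Real.log K * 2 ^ σ a v / B + B) / 2 :=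
          Finset.sum_le_sum fun v _ => h1 v
      _ = (Real.log K * ∑ v, (2 : ℝ) ^ σ a v) / (2 * B) + n * (B / 2) := by
          rw [← Finset.sum_div, Finset.sum_add_distrib, ← Finset.sum_div, Finset.mul_sum,
            Finset.sum_const, Finset.card_univ, nsmul_eq_mul, ← hn]
          field_simp
      _ ≤ n * (18 * S ^ 6 + 60 * B ^ 2) / (2 * B) + n * (B / 2) := by gcongr
      -- `30.5 = 60/2 + 1/2`; the factor `10` of the one-agent bound later turns it into `305`. The
      -- next step uses `2B ≥ 1`.
      _ = n * (18 * S ^ 6 / (2 * B) + 30.5 * B) := by field_simp; ring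
      _ ≤ _ := by
          gcongr
          exact div_le_self (by positivity) (by linarith)
  have : Nonempty (Fin K) := ⟨⟨0, by omega⟩⟩
  obtain ⟨k, hk⟩ := exists_eq_ciInf_of_finite (f := fun i : Fin K => ∑ t : Fin T, ℓ t i)
  unfold welfareRegret
  rw [← hk, ← hn]
  have h6 : ∑ v, (E (fun a => ∑ t : Fin T, ℓ t (a t v)) - ∑ t : Fin T, ℓ t k) ≤
      ∑ v, (10 * E (fun a => stageScale K (σ a v)) + d v + (d v + 1) * (2 + 2 * Real.log T)) :=
    Finset.sum_le_sum fun v _ => expect_regret_agent_le hδ hK hℓ hδT hδ1 hT v k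
  have h7 : ∑ v, E (fun a => stageScale K (σ a v)) ≤ n * (18 * S ^ 6 + 30.5 * B) := by
    rw [hE, ← expect_sum]
    exact (expect_mono hδ (by omega) hpath).trans (le_of_eq (expect_const hδ (by omega) _))
  simp only [Finset.sum_sub_distrib, Finset.sum_add_distrib, ← Finset.mul_sum, ← Finset.sum_mul,
    Finset.sum_const, Finset.card_univ, nsmul_eq_mul, mul_one, ← hn, ← hmean] at h6
  have h8 : 1 / n * ∑ v, E (fun a => ∑ t : Fin T, ℓ t (a t v)) - ∑ t : Fin T, ℓ t k =
      1 / n * (∑ v, E (fun a => ∑ t : Fin T, ℓ t (a t v)) - n * ∑ t : Fin T, ℓ t k) := by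
    field_simp
  refine h8.le.trans ?_
  rw [one_div, inv_mul_le_iff₀ hN0]
  linarith

end Welfare

end ExpCoop

end

/-! ### Assembling the final bound. -/

theorem corollaryc :
    ∃ (C : ℝ) (m : ℕ), 0 < C ∧
      ∀ (N K T : ℕ) (G : SimpleGraph (Fin N)) (d ttl : Fin N → ℕ) (ℓ : ℕ → Fin K → ℝ),
        G.Connected → 2 ≤ K → 1 ≤ T → (∀ t i, 0 ≤ ℓ t i ∧ ℓ t i ≤ 1) →
        ExpCoop.welfareRegret G d ttl (1 / (T : ℝ)) ℓ T ≤
          C * (√(Real.log K *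
                  (ExpCoop.meanDelay d + 1 +
                    (K : ℝ) / N * ExpCoop.alphaP G d ttl * Real.log ((T : ℝ) * N * K)) * T)
              + ExpCoop.meanDelay d *
                  (Real.log T + Real.log (Real.log ((T : ℝ) * N * K))))
            + C * ((N : ℝ) + K + ∑ v, (d v : ℝ)) ^ m := by
  refine ⟨1000, 6, by norm_num, ?_⟩
  intro N K T G d ttl ℓ hG hK hT hℓ
  have : Nonempty (Fin N) := hG.nonempty
  have hT1 : (1 : ℝ) ≤ T := by exact_mod_cast hT
  have hK2 : (2 : ℝ) ≤ K := by exact_mod_cast hK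
  have hN1 : (1 : ℝ) ≤ N := by
    have : 1 ≤ Fintype.card (Fin N) := Fintype.card_pos
    rw [Fintype.card_fin] at this
    exact_mod_cast this
  have hlK := ExpCoop.half_le_log hK
  have hL := ExpCoop.half_le_log_horizon (Fin N) hK hT
  have hlT := Real.log_nonneg hT1
  have hreg := ExpCoop.welfareRegret_le (G := G) (d := d) (ttl := ttl) (ℓ := ℓ) (T := T)
    (S := (N : ℝ) + K + ∑ v, (d v : ℝ)) hK hT hℓ
    (B := √(Real.log K * (ExpCoop.meanDelay d + 1 +
      (K : ℝ) / N * ExpCoop.alphaP G d ttl * Real.log ((T : ℝ) * N * K)) * T))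
  rw [Fintype.card_fin] at hL hreg
  set L := Real.log ((T : ℝ) * N * K)
  set S := (N : ℝ) + K + ∑ v, (d v : ℝ) with hS
  have hsum : 0 ≤ ∑ v, (d v : ℝ) := Finset.sum_nonneg fun v _ => Nat.cast_nonneg _
  have hdv : ∀ v, (d v : ℝ) ≤ ∑ v, (d v : ℝ) := fun v =>
    Finset.single_le_sum (f := fun v => (d v : ℝ)) (fun u _ => Nat.cast_nonneg _)
      (Finset.mem_univ v)
  have hmean0 : 0 ≤ ExpCoop.meanDelay d := mul_nonneg (by positivity) hsum
  have hmean : ExpCoop.meanDelay d ≤ S := by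
    unfold ExpCoop.meanDelay
    rw [Fintype.card_fin]
    have := mul_le_of_le_one_left hsum ((div_le_one (by linarith : (0 : ℝ) < N)).2 hN1)
    linarith
  have hX : (T : ℝ) / 2 ≤ Real.log K * (ExpCoop.meanDelay d + 1 +
      (K : ℝ) / N * ExpCoop.alphaP G d ttl * L) * T := by
    have h1 : 0 ≤ (K : ℝ) / N * ExpCoop.alphaP G d ttl * L :=
      mul_nonneg (by positivity) (by linarith)
    have h2 : 1 / 2 ≤ Real.log K * (ExpCoop.meanDelay d + 1 +
      (K : ℝ) / N * ExpCoop.alphaP G d ttl * L) := by nlinarith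
    nlinarith
  have hBsq := Real.sq_sqrt (show 0 ≤ Real.log K * (ExpCoop.meanDelay d + 1 +
      (K : ℝ) / N * ExpCoop.alphaP G d ttl * L) * T by linarith)
  have hB0 := Real.sqrt_nonneg (Real.log K * (ExpCoop.meanDelay d + 1 +
      (K : ℝ) / N * ExpCoop.alphaP G d ttl * L) * T)
  set B := √(Real.log K * (ExpCoop.meanDelay d + 1 +
      (K : ℝ) / N * ExpCoop.alphaP G d ttl * L) * T)
  -- The square-root term dominates `√T`, so it absorbs the part of `ln T` not multiplied by the
  -- mean delay.
  have hBT : √(T : ℝ) ≤ 2 * B := by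
    refine Real.sqrt_le_iff.2 ⟨by positivity, ?_⟩
    nlinarith
  have hB2 : 1 / 2 ≤ B := by
    have := Real.one_le_sqrt.2 hT1
    linarith
  have h := hreg hB2 hBsq (by linarith) (fun v => by linarith [hdv v])
  have hlogT : Real.log T ≤ 4 * B := by
    have h1 := Real.log_le_sub_one_of_pos (Real.sqrt_pos.2 (by linarith : (0 : ℝ) < T))
    rw [Real.log_sqrt (by linarith)] at h1
    linarith
  -- `ln ln(TNK)` can be negative. Including it in the bound then costs at most a multiple of the
  -- mean delay, which `S ^ 6` absorbs.
  have hloglog : -1 ≤ Real.log L := by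
    have h1 := Real.log_le_log (by norm_num) hL
    rw [one_div, Real.log_inv] at h1
    linarith [Real.log_two_lt_d9]
  have hS3 : 3 ≤ S := by linarith
  have hS6 : 243 * S ≤ S ^ 6 := by
    have : (3 : ℝ) ^ 5 ≤ S ^ 5 := pow_le_pow_left₀ (by norm_num) hS3 5
    nlinarith
  have hXX := mul_le_mul_of_nonneg_left hloglog hmean0
  have hdT := mul_nonneg hmean0 hlT
  linarith
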